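/- **Setting.** Let $1\le m\le d$ be integers, $\tau\in(0,1)$, $\eta,\eta_0>0$, $\beta,\beta'>0$, and let $\|\cdot\|$ be the Euclidean norm on $\mathbb R^d$ and the spectral norm of matrices. For $g:\mathbb R^d\to\mathbb R^d$ put $h(x)=x-g(x)$, and consider the following assumption at a point $x^*$: (i) $h(x^*)=0$; (ii) $h$ is differentiable with Lipschitz continuous Jacobian in a neighbourhood of $x^*$; (iii) all eigenvalues of the symmetric part $\tfrac12(h'(x^*)+h'(x^*)^{\mathrm T})$ are positive. Call positive constants $\hat\rho,\hat\kappa,\mu,L$ *admissible* if $h$ is differentiable on the ball $\mathcal B=\{x:\|x-x^*\|\le\hat\rho\}$ and for all $x\in\mathcal B$, $y\in\mathbb R^d$ $$\mu\|y\|\le\|h'(x)y\|\le L\|y\|,\qquad \mu\|y\|^2\le y^{\mathrm T}h'(x)y\le L\|y\|^2,\qquad \|h(x)-h'(x^*)(x-x^*)\|\le\tfrac12\hat\kappa\|x-x^*\|^2 .$$ **Restarted Anderson mixing (AM)** with mixing parameters $\beta_k$, from $x_0$. Write $r_k=g(x_k)-x_k$, and $v_j=p_j$ for Type-I, $v_j=q_j$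 for Type-II. Start with $m_0=0$. Iteration $k=0,1,\dots$ does the following. 1. If $m_k>m$ or $\|r_k\|>\eta\|r_{k-m_k}\|$, set $m_k=0$. 2. If $m_k>0$: set $p_k=x_k-x_{k-1}$, $q_k=r_k-r_{k-1}$; for $j=1,\dots,m_k-1$ put $\zeta=(v_{k-m_k+j}^{\mathrm T}q_k)/(v_{k-m_k+j}^{\mathrm T}q_{k-m_k+j})$ and replace $p_k$ by $p_k-\zeta p_{k-m_k+j}$ and $q_k$ by $q_k-\zeta q_{k-m_k+j}$. Then, if $|v_k^{\mathrm T}q_k|<\tau|v_{k-m_k+1}^{\mathrm T}q_{k-m_k+1}|$, set $m_k=0$. 3. Set $\bar x_k=x_k$, $\bar r_k=r_k$; for $j=1,\dots,m_k$ put $\gamma=(v_{k-m_k+j}^{\mathrm T}\bar r_k)/(v_{k-m_k+j}^{\mathrm T}q_{k-m_k+j})$ and replace $\bar x_k$ by $\bar x_k-\gamma p_{k-m_k+j}$ and $\bar r_k$ by $\bar r_k-\gamma q_{k-m_k+j}$. 4. Set $x_{k+1}=\bar x_k+\beta_k\bar r_k$ and let $m_{k+1}=m_k+1$ be the value entering iteration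 $k+1$. Quotients with denominator $0$ are read as $0$. Below, $m_k$ is its value at the end of iteration $k$. **Notation.** $A=I-g'(x^*)$, $\theta_k=\|I-\beta_kA\|$, $\mathcal P_n$ is the set of real polynomials of degree at most $n$, $\mathcal K_n(A,v)=\mathrm{span}\{v,Av,\dots,A^{n-1}v\}$, $\pi_k$ is the orthogonal projector onto $\mathcal K_{m_k}(A,r_{k-m_k})$, $A_k=\pi_kA\pi_k$, $\gamma_k=\|\pi_kA(I-\pi_k)\|$ and $\kappa_k=\|(A_k|_{\mathcal K_{m_k}(A,r_{k-m_k})})^{-1}\|$. **Theorem 4.1.** Whenever $g$ and $x^*$ satisfy (i)–(iii), admissible constants exist. Moreover, for all $\mu,L>0$ there is a constant $C>0$, depending only on $d,m,\tau,\eta,\eta_0,\beta,\beta',\mu,L$, such that for all $g,x^*$ satisfying (i)–(iii) and all $\hat\rho,\hat\kappa$ for which $\hat\rho,\hat\kappa,\mu,L$ are admissible, the following hold. 1. *Type-I.* There is $\delta>0$ such that for every run of restarted Type-I AM with all $\beta_j\in[\beta,\beta']$ and $\|x_0-x^*\|\le\delta$, and every $k\ge0$ with $\|r_j\|\le\eta_0\|r_0\|$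 for $0\le j\le k$: the restriction of $A_k$ to $\mathcal K_{m_k}(A,r_{k-m_k})$ is invertible, $\gamma_k\le L$, $\kappa_k\le1/\mu$, and $$\|x_{k+1}-x^*\|\le\theta_k\sqrt{1+\gamma_k^2\kappa_k^2}\ \min_{p\in\mathcal P_{m_k},\,p(0)=1}\|p(A)(x_{k-m_k}-x^*)\|+\hat\kappa\,C\,\|x_{k-m_k}-x^*\|^2 .$$ 2. *Type-II.* There is $\delta>0$ such that for every run of restarted Type-II AM with all $\beta_j\in[\beta,\beta']$ and $\|x_0-x^*\|\le\delta$, and every $k\ge0$ with $\|r_j\|\le\eta_0\|r_0\|$ for $0\le j\le k+1$, $$\|r_{k+1}\|\le\theta_k\min_{p\in\mathcal P_{m_k},\,p(0)=1}\|p(A)r_{k-m_k}\|+\hat\kappa\,C\,\|x_{k-m_k}-x^*\|^2 .\tag{$*$}$$ Alternatively, for every $\theta\in[(1-\mu^2/L^2)^{1/2},1)$ there is $\delta>0$ such that for every run of restarted Type-II AM with all $\beta_j\in[\beta,\beta']$, $\theta_j\le\theta$ for all $j\ge0$, and $\|x_0-x^*\|\le\delta$, the bound $(*)$ holds for every $k\ge0$.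 3. *$(d+1)$-step quadratic convergence.* In each of the situations of 1 and 2, if $m_k=d$, then $\|x_{k+1}-x^*\|\le\hat\kappa\,C\,\|x_{k-m_k}-x^*\|^2$. All minima are attained. -/

import Mathlib

noncomputable section

namespace RestartedAM

/-- The space `ℝ^d` with the Euclidean norm. -/
abbrev Vec (d : ℕ) := EuclideanSpace ℝ (Fin d)

/-- The two variants of Anderson mixing. -/
inductive AMType
  | typeI
  | typeII

/-- `h(x) = x - g(x)`. -/
def hMap {d : ℕ} (g : Vec d → Vec d) (x : Vec d) : Vec d := x - g x

/-- The residual `g(x) - x` at the point `x`. -/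
def residual {d : ℕ} (g : Vec d → Vec d) (x : Vec d) : Vec d := g x - x

/-- The vectors `v_j`: `v_j = p_j` for Type-I and `v_j = q_j` for Type-II. -/
def vVec {d : ℕ} (ty : AMType) (p q : ℕ → Vec d) : ℕ → Vec d :=
  match ty with
  | AMType.typeI => p
  | AMType.typeII => q

/-- The inner loop of the method.  Starting from the pair `y = (y₁, y₂)`, for `j = 1, …, n` put
`ζ = (v_{s+j}ᵀ y₂) / (v_{s+j}ᵀ q_{s+j})` and replace `(y₁, y₂)` by
`(y₁ - ζ p_{s+j}, y₂ - ζ q_{s+j})`. -/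
def sweep {d : ℕ} (ty : AMType) (p q : ℕ → Vec d) (s : ℕ) (y : Vec d × Vec d) :
    ℕ → Vec d × Vec d
  | 0 => y
  | j + 1 =>
    let w := sweep ty p q s y j
    let ζ : ℝ := inner ℝ (vVec ty p q (s + (j + 1))) w.2 /
      inner ℝ (vVec ty p q (s + (j + 1))) (q (s + (j + 1)))
    (w.1 - ζ • p (s + (j + 1)), w.2 - ζ • q (s + (j + 1)))

/-- The value with which `m_k` enters iteration `k`: `0` for `k = 0`, and `m_{k-1} + 1` otherwise.
It never exceeds `k`. -/
def enteringDepth (mk : ℕ → ℕ) : ℕ → ℕ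
  | 0 => 0
  | k + 1 => mk k + 1

/-- The value of `m_k` after the first restart test of iteration `k`
(`m_k > m` or `‖r_k‖ > η ‖r_{k-m_k}‖`). -/
def testedDepth {d : ℕ} (g : Vec d → Vec d) (m : ℕ) (η : ℝ) (x : ℕ → Vec d) (mk : ℕ → ℕ)
    (k : ℕ) : ℕ :=
  if m < enteringDepth mk k ∨
      η * ‖residual g (x (k - enteringDepth mk k))‖ < ‖residual g (x k)‖
  then 0 else enteringDepth mk k

/-- `x, mk, p, q` are the sequences `x_k, m_k, p_k, q_k` produced by the restarted Anderson mixing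
method of the given type for the fixed-point map `g`, with mixing parameters `b k` and restart
parameters `m, τ, η`.  Here `mk k` is the final value of `m_k` in iteration `k`, the one used
to form `x_{k+1}`. -/
structure IsRun {d : ℕ} (ty : AMType) (g : Vec d → Vec d) (b : ℕ → ℝ) (m : ℕ) (τ η : ℝ)
    (x : ℕ → Vec d) (mk : ℕ → ℕ) (p q : ℕ → Vec d) : Prop where
  /-- Construction of the new pair `(p_k, q_k)` when `m_k > 0` after the first restart test. -/
  newPair : ∀ k, 0 < testedDepth g m η x mk k →
    (p k, q k) = sweep ty p q (k - testedDepth g m η x mk k)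
      (x k - x (k - 1), residual g (x k) - residual g (x (k - 1)))
      (testedDepth g m η x mk k - 1)
  /-- The second restart test: `|v_kᵀ q_k| < τ |v_{k-m_k+1}ᵀ q_{k-m_k+1}|`. -/
  depth : ∀ k, mk k =
    if 0 < testedDepth g m η x mk k ∧
      |inner ℝ (vVec ty p q k) (q k)| <
        τ * |inner ℝ (vVec ty p q (k - testedDepth g m η x mk k + 1))
          (q (k - testedDepth g m η x mk k + 1))|
    then 0 else testedDepth g m η x mk k
  /-- Projection step and mixing step: `x_{k+1} = x̄_k + β_k r̄_k`. -/
  update : ∀ k, x (k + 1) =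
    (sweep ty p q (k - mk k) (x k, residual g (x k)) (mk k)).1 +
      b k • (sweep ty p q (k - mk k) (x k, residual g (x k)) (mk k)).2

theorem sweep_congr {d : ℕ} (ty : AMType) (p q p' q' : ℕ → Vec d) (s : ℕ) (y : Vec d × Vec d)
    (n : ℕ) (hp : ∀ i ≤ s + n, p i = p' i) (hq : ∀ i ≤ s + n, q i = q' i) :
    sweep ty p q s y n = sweep ty p' q' s y n := by
  induction n with
  | zero => rfl
  | succ n ih =>
    have h1 := hp (s + (n + 1)) le_rfl
    have h2 := hq (s + (n + 1)) le_rfl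
    have h3 : vVec ty p q (s + (n + 1)) = vVec ty p' q' (s + (n + 1)) := by
      cases ty
      · exact h1
      · exact h2
    have ih' := ih (fun i hi => hp i (by omega)) (fun i hi => hq i (by omega))
    simp only [sweep, ih', h1, h2, h3]

/-- For every starting point the method has a run, so `IsRun` is satisfiable. -/
theorem exists_isRun {d : ℕ} (ty : AMType) (g : Vec d → Vec d) (b : ℕ → ℝ) (m : ℕ) (τ η : ℝ)
    (x₀ : Vec d) : ∃ (x : ℕ → Vec d) (mk : ℕ → ℕ) (p q : ℕ → Vec d),
      x 0 = x₀ ∧ IsRun ty g b m τ η x mk p q := by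
  classical
  -- one iteration, acting on tables of the sequences
  let T := (ℕ → Vec d) × (ℕ → ℕ) × (ℕ → Vec d) × (ℕ → Vec d)
  let pair : ℕ → T → Vec d × Vec d := fun k t =>
    sweep ty t.2.2.1 t.2.2.2 (k - testedDepth g m η t.1 t.2.1 k)
      (t.1 k - t.1 (k - 1), residual g (t.1 k) - residual g (t.1 (k - 1)))
      (testedDepth g m η t.1 t.2.1 k - 1)
  let pn : ℕ → T → ℕ → Vec d := fun k t => Function.update t.2.2.1 k (pair k t).1
  let qn : ℕ → T → ℕ → Vec d := fun k t => Function.update t.2.2.2 k (pair k t).2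
  let dep : ℕ → T → ℕ := fun k t =>
    if 0 < testedDepth g m η t.1 t.2.1 k ∧
      |inner ℝ (vVec ty (pn k t) (qn k t) k) (qn k t k)| <
        τ * |inner ℝ (vVec ty (pn k t) (qn k t) (k - testedDepth g m η t.1 t.2.1 k + 1))
          (qn k t (k - testedDepth g m η t.1 t.2.1 k + 1))|
    then 0 else testedDepth g m η t.1 t.2.1 k
  let w : ℕ → T → Vec d × Vec d := fun k t =>
    sweep ty (pn k t) (qn k t) (k - dep k t) (t.1 k, residual g (t.1 k)) (dep k t)
  let step : ℕ → T → T := fun k t =>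
    (Function.update t.1 (k + 1) ((w k t).1 + b k • (w k t).2),
      Function.update t.2.1 k (dep k t), pn k t, qn k t)
  let t : ℕ → T := fun n =>
    Nat.rec (motive := fun _ => T) (fun _ => x₀, fun _ => 0, fun _ => 0, fun _ => 0) step n
  have ts : ∀ n, t (n + 1) = step n (t n) := fun n => rfl
  -- entries of the tables are final once written
  have hx : ∀ n i, i ≤ n → (t n).1 i = (t i).1 i := by
    intro n
    induction n with
    | zero => intro i hi; obtain rfl : i = 0 := by omega
              rfl
    | succ n ih =>
      intro i hi
      rcases Nat.lt_or_ge n i with h | h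
      · obtain rfl : i = n + 1 := by omega
        rfl
      · rw [ts, ← ih i h]
        exact Function.update_of_ne (by omega) _ _
  have hm : ∀ n i, i < n → (t n).2.1 i = (t (i + 1)).2.1 i := by
    intro n
    induction n with
    | zero => intro i hi; omega
    | succ n ih =>
      intro i hi
      rcases Nat.lt_or_ge i n with h | h
      · rw [ts n, ← ih i h]
        exact Function.update_of_ne (by omega) _ _
      · obtain rfl : i = n := by omega
        rfl
  have hp : ∀ n i, i < n → (t n).2.2.1 i = (t (i + 1)).2.2.1 i := by
    intro n
    induction n with
    | zero => intro i hi; omega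
    | succ n ih =>
      intro i hi
      rcases Nat.lt_or_ge i n with h | h
      · rw [ts n, ← ih i h]
        exact Function.update_of_ne (by omega) _ _
      · obtain rfl : i = n := by omega
        rfl
  have hq : ∀ n i, i < n → (t n).2.2.2 i = (t (i + 1)).2.2.2 i := by
    intro n
    induction n with
    | zero => intro i hi; omega
    | succ n ih =>
      intro i hi
      rcases Nat.lt_or_ge i n with h | h
      · rw [ts n, ← ih i h]
        exact Function.update_of_ne (by omega) _ _
      · obtain rfl : i = n := by omega
        rfl
  let X : ℕ → Vec d := fun k => (t k).1 k
  let M : ℕ → ℕ := fun k => (t (k + 1)).2.1 k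
  let P : ℕ → Vec d := fun k => (t (k + 1)).2.2.1 k
  let Q : ℕ → Vec d := fun k => (t (k + 1)).2.2.2 k
  have hent : ∀ k, enteringDepth (t k).2.1 k = enteringDepth M k := by
    intro k
    cases k with
    | zero => rfl
    | succ k => rfl
  have htest : ∀ k, testedDepth g m η (t k).1 (t k).2.1 k = testedDepth g m η X M k := by
    intro k
    simp only [testedDepth, hent, hx k _ (Nat.sub_le _ _)]
    rfl
  have hle : ∀ k, testedDepth g m η X M k ≤ enteringDepth M k := by
    intro k
    unfold testedDepth
    split_ifs <;> omega
  have hMdep : ∀ k, M k = dep k (t k) := fun k => Function.update_self _ _ _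
  have hdeple : ∀ k, dep k (t k) ≤ testedDepth g m η X M k := by
    intro k
    simp only [dep, htest]
    split_ifs <;> omega
  have hentk : ∀ k, enteringDepth M k ≤ k := by
    intro k
    induction k with
    | zero => exact le_rfl
    | succ k ih =>
      have := hMdep k
      have := hdeple k
      have := hle k
      change M k + 1 ≤ k + 1
      omega
  have hP : ∀ k, ∀ i ≤ k, pn k (t k) i = P i := fun k i hi => hp (k + 1) i (by omega)
  have hQ : ∀ k, ∀ i ≤ k, qn k (t k) i = Q i := fun k i hi => hq (k + 1) i (by omega)
  have hV : ∀ k, ∀ i ≤ k, vVec ty (pn k (t k)) (qn k (t k)) i = vVec ty P Q i := by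
    intro k i hi
    cases ty
    · exact hP k i hi
    · exact hQ k i hi
  refine ⟨X, M, P, Q, rfl, ?_, ?_, ?_⟩
  · intro k hk
    have h1 : (P k, Q k) = pair k (t k) :=
      Prod.ext (Function.update_self _ _ _) (Function.update_self _ _ _)
    have := hle k
    have := hentk k
    rw [h1]
    simp only [pair, htest, hx k (k - 1) (Nat.sub_le _ _)]
    exact sweep_congr _ _ _ _ _ _ _ _ (fun i hi => hp k i (by omega))
      (fun i hi => hq k i (by omega))
  · intro k
    have := hle k
    have := hentk k
    rw [hMdep k]
    simp only [dep, htest]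
    by_cases h0 : 0 < testedDepth g m η X M k
    · rw [hV k k le_rfl, hQ k k le_rfl, hV k _ (by omega), hQ k _ (by omega)]
    · simp [h0]
  · intro k
    have := hle k
    have := hentk k
    have := hdeple k
    have h1 : X (k + 1) = (w k (t k)).1 + b k • (w k (t k)).2 := Function.update_self _ _ _
    have h2 : w k (t k) = sweep ty P Q (k - M k) (X k, residual g (X k)) (M k) := by
      rw [hMdep k]
      exact sweep_congr _ _ _ _ _ _ _ _ (fun i hi => hP k i (by omega))
        (fun i hi => hQ k i (by omega))
    rw [h1, h2]

/-- The symmetric part `(A + Aᵀ) / 2`. -/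
def symPart {d : ℕ} (A : Vec d →L[ℝ] Vec d) : Vec d →L[ℝ] Vec d :=
  (1 / 2 : ℝ) • (A + ContinuousLinearMap.adjoint A)

/-- The standing assumption: `h(x*) = 0`; `h` is differentiable with Lipschitz continuous
derivative in a neighbourhood of `x*`; all eigenvalues of the symmetric part of `h'(x*)` are
positive. -/
structure Assumption {d : ℕ} (g : Vec d → Vec d) (xs : Vec d) : Prop where
  zero : hMap g xs = 0
  smooth : ∃ U ∈ nhds xs, (∀ x ∈ U, DifferentiableAt ℝ (hMap g) x) ∧
    ∃ K : NNReal, LipschitzOnWith K (fderiv ℝ (hMap g)) U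
  posDef : ∀ ν : ℝ,
    Module.End.HasEigenvalue (symPart (fderiv ℝ (hMap g) xs) : Vec d →ₗ[ℝ] Vec d) ν → 0 < ν

/-- The positive constants `ρ, κ, μ, L` are admissible for `h` at `x*`: the bounds below hold
on the closed ball of radius `ρ` around `x*`. -/
structure LocalBounds {d : ℕ} (g : Vec d → Vec d) (xs : Vec d) (ρ κ μ L : ℝ) : Prop where
  rho_pos : 0 < ρ
  kappa_pos : 0 < κ
  mu_pos : 0 < μ
  L_pos : 0 < L
  differentiable : ∀ x ∈ Metric.closedBall xs ρ, DifferentiableAt ℝ (hMap g) x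
  norm_bounds : ∀ x ∈ Metric.closedBall xs ρ, ∀ y : Vec d,
    μ * ‖y‖ ≤ ‖fderiv ℝ (hMap g) x y‖ ∧ ‖fderiv ℝ (hMap g) x y‖ ≤ L * ‖y‖
  form_bounds : ∀ x ∈ Metric.closedBall xs ρ, ∀ y : Vec d,
    μ * ‖y‖ ^ 2 ≤ inner ℝ y (fderiv ℝ (hMap g) x y) ∧
      inner ℝ y (fderiv ℝ (hMap g) x y) ≤ L * ‖y‖ ^ 2
  quadratic : ∀ x ∈ Metric.closedBall xs ρ,
    ‖hMap g x - fderiv ℝ (hMap g) xs (x - xs)‖ ≤ 1 / 2 * κ * ‖x - xs‖ ^ 2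

/-- `A = I - g'(x*)`. -/
def jac {d : ℕ} (g : Vec d → Vec d) (xs : Vec d) : Vec d →L[ℝ] Vec d :=
  ContinuousLinearMap.id ℝ (Vec d) - fderiv ℝ g xs

/-- `θ = ‖I - β A‖`, the spectral norm. -/
def theta {d : ℕ} (A : Vec d →L[ℝ] Vec d) (β : ℝ) : ℝ :=
  ‖ContinuousLinearMap.id ℝ (Vec d) - β • A‖

/-- The Krylov subspace `span {v, A v, …, A^{n-1} v}`. -/
def krylov {d : ℕ} (A : Vec d →L[ℝ] Vec d) (n : ℕ) (v : Vec d) : Submodule ℝ (Vec d) :=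
  Submodule.span ℝ (Set.range fun i : Fin n => (A ^ (i : ℕ)) v)

/-- `γ = ‖π A (I - π)‖`, with `π` the orthogonal projector onto `W`. -/
def gam {d : ℕ} (A : Vec d →L[ℝ] Vec d) (W : Submodule ℝ (Vec d)) : ℝ :=
  ‖W.starProjection ∘L A ∘L (ContinuousLinearMap.id ℝ (Vec d) - W.starProjection)‖

/-- The restriction of `π A π` to `W`, as an operator `W → W`, with `π` the orthogonal projector
onto `W`. -/
def compression {d : ℕ} (A : Vec d →L[ℝ] Vec d) (W : Submodule ℝ (Vec d)) : W →L[ℝ] W :=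
  W.orthogonalProjectionOnto ∘L A ∘L W.starProjection ∘L W.subtypeL

/-- `κ = ‖(π A π |_W)⁻¹‖`. -/
def kap {d : ℕ} (A : Vec d →L[ℝ] Vec d) (W : Submodule ℝ (Vec d)) : ℝ :=
  ‖(compression A W).inverse‖

/-- The values `‖p(A) u‖`, for real polynomials `p` of degree at most `n` with `p(0) = 1`. -/
def polyValues {d : ℕ} (A : Vec d →L[ℝ] Vec d) (n : ℕ) (u : Vec d) : Set ℝ :=
  {t | ∃ p : Polynomial ℝ, p.natDegree ≤ n ∧ p.eval 0 = 1 ∧ t = ‖Polynomial.aeval A p u‖}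

/-- The conclusion for Type-I at iteration `k`, where `n = m_k`, `x₀ = x_{k-m_k}` is the point of
the last restart, `x₁ = x_{k+1}` and `β = β_k`; `κ * C` is the constant of the quadratic term. -/
def BoundI {d : ℕ} (g : Vec d → Vec d) (xs : Vec d) (κ μ L C β : ℝ) (n : ℕ)
    (x₀ x₁ : Vec d) : Prop :=
  (compression (jac g xs) (krylov (jac g xs) n (residual g x₀))).IsInvertible ∧
  gam (jac g xs) (krylov (jac g xs) n (residual g x₀)) ≤ L ∧
  kap (jac g xs) (krylov (jac g xs) n (residual g x₀)) ≤ 1 / μ ∧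
  ∃ M : ℝ, IsLeast (polyValues (jac g xs) n (x₀ - xs)) M ∧
    ‖x₁ - xs‖ ≤ theta (jac g xs) β *
        Real.sqrt (1 + gam (jac g xs) (krylov (jac g xs) n (residual g x₀)) ^ 2 *
          kap (jac g xs) (krylov (jac g xs) n (residual g x₀)) ^ 2) * M +
      κ * (C * ‖x₀ - xs‖ ^ 2)

/-- The conclusion for Type-II at iteration `k`, in the same notation. -/
def BoundII {d : ℕ} (g : Vec d → Vec d) (xs : Vec d) (κ C β : ℝ) (n : ℕ)
    (x₀ x₁ : Vec d) : Prop :=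
  ∃ M : ℝ, IsLeast (polyValues (jac g xs) n (residual g x₀)) M ∧
    ‖residual g x₁‖ ≤ theta (jac g xs) β * M + κ * (C * ‖x₀ - xs‖ ^ 2)

end RestartedAM

end

noncomputable section

namespace RestartedAM

variable {d : ℕ}

/-! Between two restarts the method is a perturbed Krylov method for `A`, and the restart tests keep
the perturbation quadratic. Let `s` be the last restart, `E = ‖x s - xs‖`, and `ε = κ * E ^ 2`.

Conditioning (`Cycle.exists_frame`). The residual test and the lower bound `μ ‖x - xs‖ ≤ ‖r‖` keep
all iterates and residuals of the cycle of size `O(E)`. The first direction is `b_s r_s`, so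
monotonicity of `h` gives `|v_{s+1}ᵀ q_{s+1}| ≥ c E²`, and the second test passes this on to all
later pairs. As `v_iᵀ q_j = 0` for `i < j`, the directions are triangular with pivots of order `E²`,
so every coefficient is bounded by a constant that does not depend on the run.

Krylov structure (`Cycle.exists_nearPair_dirs`, `Cycle.exists_krylovFit`). Since `r = -A (x - xs) +
O(ε)`, each pair `(p, q)` is `O(ε)`-close to some `(z, -A z)` with `z` in the Krylov space of any
vector `w` with `‖r s - w‖ ≤ ε`. When `κ E` is small the vectors `z` remain independent. They
therefore span the Krylov space, which has full dimension `n`.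

Optimality. The last projected residual `R` is orthogonal to all `v_i`. For Type-II this is least
squares over `A K`, up to `O(ε)` (`Cycle.exists_bound_typeII`). For Type-I it is a Galerkin
condition on `K`, whose quasi-optimality constant is `√(1 + γ² κ²)` (`norm_le_of_galerkin`,
`Cycle.exists_bound_typeI`). The mixing step multiplies by `I - b A`. At depth `d` the Krylov space
is everything, the minimum is zero, and only the quadratic term remains.

Globally, residuals comparable with the first one keep the iterates in the ball
(`IsRun.exists_invariant`). If `θ_j ≤ θ < 1`, the Type-II bound itself prevents growth of the
residuals. -/

/-! ### The inner loop: orthogonality and size of its coefficients -/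

theorem sweep_of_snd_eq_zero (ty : AMType) (p q : ℕ → Vec d) (s : ℕ) (y : Vec d) (n : ℕ) :
    sweep ty p q s (y, 0) n = (y, 0) := by
  induction n with
  | zero => rfl
  | succ n ih => simp [sweep, ih]

/-- Each step removes the component seen by its own `v`; the later vectors `q` are orthogonal to the
earlier `v`, so nothing removed comes back. -/
theorem sweep_inner_eq_zero (ty : AMType) (p q : ℕ → Vec d) (s : ℕ) (y : Vec d × Vec d) (n : ℕ)
    (hne : ∀ i < n, inner ℝ (vVec ty p q (s + (i + 1))) (q (s + (i + 1))) ≠ 0)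
    (horth : ∀ j < n, ∀ i < j, inner ℝ (vVec ty p q (s + (i + 1))) (q (s + (j + 1))) = 0) :
    ∀ i < n, inner ℝ (vVec ty p q (s + (i + 1))) (sweep ty p q s y n).2 = 0 := by
  induction n with
  | zero => intro i hi; omega
  | succ n ih =>
    have ih' := ih (fun i hi => hne i (by omega)) (fun j hj => horth j (by omega))
    intro i hi
    simp only [sweep, inner_sub_right, inner_smul_right]
    rcases Nat.lt_or_ge i n with h | h
    · rw [ih' i h, horth n (by omega) i h]; simp
    · obtain rfl : i = n := by omega
      rw [div_mul_cancel₀ _ (hne i hi), sub_self]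

/-- The scaling matters: vectors of size `E` and pivots of size `E ^ 2` make each quotient `O(‖y.2‖
/ E)`. Fixing `N` in advance makes `D` uniform in `E`, in the run and in the length `n ≤ N`. -/
theorem sweep_eq_sum {a c : ℝ} (ha : 0 < a) (hc : 0 < c) (N : ℕ) :
    ∃ D : ℝ, 0 < D ∧ ∀ (ty : AMType) (p q : ℕ → Vec d) (s : ℕ) (E : ℝ), 0 < E →
      ∀ n ≤ N,
      (∀ i < n, ‖p (s + (i + 1))‖ ≤ a * E) → (∀ i < n, ‖q (s + (i + 1))‖ ≤ a * E) →
      (∀ i < n, c * E ^ 2 ≤ |inner ℝ (vVec ty p q (s + (i + 1))) (q (s + (i + 1)))|) →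
      ∀ y : Vec d × Vec d, ∃ ζ : ℕ → ℝ, (∀ i < n, |ζ i| * E ≤ D * ‖y.2‖) ∧
        sweep ty p q s y n = (y.1 - ∑ i ∈ Finset.range n, ζ i • p (s + (i + 1)),
          y.2 - ∑ i ∈ Finset.range n, ζ i • q (s + (i + 1))) := by
  induction N with
  | zero =>
    refine ⟨1, one_pos, fun ty p q s E hE n hn hp hq hv y => ⟨0, ?_, ?_⟩⟩
    · intro i hi; omega
    · obtain rfl : n = 0 := by omega
      simp [sweep]
  | succ N ih =>
    obtain ⟨D, hD, H⟩ := ih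
    -- The added term bounds the last quotient: its numerator is at most `a E (1 + N D a) ‖y.2‖`,
    -- its denominator at least `c E ^ 2`.
    refine ⟨D + a / c * (1 + N * D * a), by positivity,
      fun ty p q s E hE n hn hp hq hv y => ?_⟩
    have hDle : D ≤ D + a / c * (1 + N * D * a) := le_add_of_nonneg_right (by positivity)
    rcases Nat.lt_or_ge N n with h | h
    swap
    · obtain ⟨ζ, h1, h2⟩ := H ty p q s E hE n h hp hq hv y
      exact ⟨ζ, fun i hi => (h1 i hi).trans (by gcongr), h2⟩
    obtain rfl : n = N + 1 := by omega
    obtain ⟨ζ, h1, h2⟩ := H ty p q s E hE N le_rfl (fun i hi => hp i (by omega))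
      (fun i hi => hq i (by omega)) (fun i hi => hv i (by omega)) y
    set w := sweep ty p q s y N with hw
    set z : ℝ := inner ℝ (vVec ty p q (s + (N + 1))) w.2 /
      inner ℝ (vVec ty p q (s + (N + 1))) (q (s + (N + 1))) with hz
    have hwn : ‖w.2‖ ≤ (1 + N * D * a) * ‖y.2‖ := by
      rw [h2]
      calc ‖y.2 - ∑ i ∈ Finset.range N, ζ i • q (s + (i + 1))‖
          ≤ ‖y.2‖ + ‖∑ i ∈ Finset.range N, ζ i • q (s + (i + 1))‖ := norm_sub_le _ _
        _ ≤ ‖y.2‖ + ∑ i ∈ Finset.range N, D * ‖y.2‖ * a := by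
            gcongr
            refine norm_sum_le_of_le _ fun i hi => ?_
            have hi' := Finset.mem_range.1 hi
            rw [norm_smul, Real.norm_eq_abs]
            calc |ζ i| * ‖q (s + (i + 1))‖ ≤ |ζ i| * (a * E) := by
                  gcongr; exact hq i (by omega)
              _ = |ζ i| * E * a := by ring
              _ ≤ D * ‖y.2‖ * a := mul_le_mul_of_nonneg_right (h1 i hi') ha.le
        _ = (1 + N * D * a) * ‖y.2‖ := by
            rw [Finset.sum_const, Finset.card_range, nsmul_eq_mul]; ring
    have hvn : ‖vVec ty p q (s + (N + 1))‖ ≤ a * E := by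
      cases ty
      · exact hp N (by omega)
      · exact hq N (by omega)
    have hzb : |z| * E ≤ a / c * (1 + N * D * a) * ‖y.2‖ := by
      have hv' := hv N (by omega)
      have hpos : 0 < c * E ^ 2 := by positivity
      rw [hz, abs_div, div_mul_eq_mul_div, div_le_iff₀ (hpos.trans_le hv')]
      calc |inner ℝ (vVec ty p q (s + (N + 1))) w.2| * E
          ≤ ‖vVec ty p q (s + (N + 1))‖ * ‖w.2‖ * E := by
            gcongr; exact abs_real_inner_le_norm _ _
        _ ≤ (a * E) * ((1 + N * D * a) * ‖y.2‖) * E := by gcongr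
        _ = a / c * (1 + N * D * a) * ‖y.2‖ * (c * E ^ 2) := by field_simp
        _ ≤ _ := by gcongr
    refine ⟨fun i => if i < N then ζ i else z, fun i hi => ?_, ?_⟩
    · by_cases hiN : i < N
      · simp only [hiN, if_true]; exact (h1 i hiN).trans (by gcongr)
      · simp only [hiN, if_false]
        refine hzb.trans ?_
        gcongr
        linarith
    · have e1 : ∀ f : ℕ → Vec d, ∑ i ∈ Finset.range (N + 1), (if i < N then ζ i else z) • f i
          = (∑ i ∈ Finset.range N, ζ i • f i) + z • f N := by
        intro f
        rw [Finset.sum_range_succ]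
        congr 1
        · exact Finset.sum_congr rfl fun i hi => by simp [Finset.mem_range.1 hi]
        · simp
      rw [e1 (fun i => p (s + (i + 1))), e1 (fun i => q (s + (i + 1)))]
      change (w.1 - z • p (s + (N + 1)), w.2 - z • q (s + (N + 1))) = _
      rw [h2]
      simp only [sub_sub]

/-- Coefficients with respect to a family that is triangular against bounded test vectors. -/
theorem coeff_bound_of_triangular {a c : ℝ} (ha : 0 < a) (hc : 0 < c) (N : ℕ) :
    ∃ B : ℝ, 0 < B ∧ ∀ (v q : ℕ → Vec d) (n : ℕ) (E : ℝ), 0 < E →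
      (∀ i < n, ‖v i‖ ≤ a * E) → (∀ i < n, ‖q i‖ ≤ a * E) →
      (∀ i < n, c * E ^ 2 ≤ |inner ℝ (v i) (q i)|) →
      (∀ j < n, ∀ i < j, inner ℝ (v i) (q j) = 0) →
      ∀ ζ : ℕ → ℝ, ∀ i < n, i < N →
        |ζ i| * E ≤ B * ‖∑ j ∈ Finset.range n, ζ j • q j‖ := by
  induction N with
  | zero => exact ⟨1, one_pos, fun _ _ _ _ _ _ _ _ _ _ _ _ h => by omega⟩
  | succ N ih =>
    obtain ⟨B, hB, H⟩ := ih
    refine ⟨B + a / c * (1 + N * B * a), by positivity,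
      fun v q n E hE hv hq hd ho ζ i hin hiN => ?_⟩
    set y := ∑ j ∈ Finset.range n, ζ j • q j with hy
    have hBle : B ≤ B + a / c * (1 + N * B * a) := le_add_of_nonneg_right (by positivity)
    have H' := H v q n E hE hv hq hd ho ζ
    rcases Nat.lt_or_ge i N with h | h
    · exact (H' i hin h).trans (by gcongr)
    obtain rfl : i = N := by omega
    -- Forward substitution: pairing with `v i` kills all terms of index above `i`, and the earlier
    -- coefficients are already bounded.
    have e : inner ℝ (v i) y = (∑ j ∈ Finset.range i, ζ j * inner ℝ (v i) (q j)) +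
        ζ i * inner ℝ (v i) (q i) := by
      rw [hy, inner_sum, ← Finset.sum_range_succ (fun j => ζ j * inner ℝ (v i) (q j)) i]
      simp only [inner_smul_right]
      symm
      refine Finset.sum_subset (fun j hj => ?_) (fun j hj hj' => ?_)
      · simp only [Finset.mem_range] at hj ⊢; omega
      · simp only [Finset.mem_range] at hj hj'
        rw [ho j hj i (by omega), mul_zero]
    have hs : |∑ j ∈ Finset.range i, ζ j * inner ℝ (v i) (q j)| ≤ i * (B * ‖y‖ * a * (a * E)) := by
      refine (Finset.abs_sum_le_sum_abs _ _).trans ?_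
      rw [← nsmul_eq_mul]
      conv_rhs => rw [← Finset.card_range i]
      refine Finset.sum_le_card_nsmul _ _ _ fun j hj => ?_
      have hj' := Finset.mem_range.1 hj
      rw [abs_mul]
      calc |ζ j| * |inner ℝ (v i) (q j)| ≤ |ζ j| * (‖v i‖ * ‖q j‖) := by
            gcongr; exact abs_real_inner_le_norm _ _
        _ ≤ |ζ j| * ((a * E) * (a * E)) := by
            gcongr
            · exact hv i hin
            · exact hq j (by omega)
        _ = (|ζ j| * E) * a * (a * E) := by ring
        _ ≤ B * ‖y‖ * a * (a * E) :=
            mul_le_mul_of_nonneg_right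
              (mul_le_mul_of_nonneg_right (H' j (by omega) hj') ha.le) (by positivity)
    have h1 : |ζ i| * |inner ℝ (v i) (q i)| ≤ a * E * ‖y‖ + i * (B * ‖y‖ * a * (a * E)) := by
      rw [← abs_mul]
      have : ζ i * inner ℝ (v i) (q i) = inner ℝ (v i) y -
        ∑ j ∈ Finset.range i, ζ j * inner ℝ (v i) (q j) := by rw [e]; ring
      rw [this]
      refine (abs_sub _ _).trans (add_le_add ?_ hs)
      exact (abs_real_inner_le_norm _ _).trans (by gcongr; exact hv i hin)
    have h2 : |ζ i| * (c * E ^ 2) ≤ a * E * ‖y‖ + i * (B * ‖y‖ * a * (a * E)) :=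
      le_trans (by gcongr; exact hd i hin) h1
    have h3 : |ζ i| * E ≤ a / c * (1 + i * B * a) * ‖y‖ := by
      have : (|ζ i| * E) * (c * E) ≤ (a / c * (1 + i * B * a) * ‖y‖) * (c * E) := by
        calc (|ζ i| * E) * (c * E) = |ζ i| * (c * E ^ 2) := by ring
          _ ≤ _ := h2
          _ = _ := by field_simp
      exact le_of_mul_le_mul_right this (by positivity)
    refine h3.trans ?_
    gcongr
    linarith

/-! ### Coercive operators -/

/-- The spectral bounds `μ ‖y‖² ≤ yᵀ A y` and `‖A y‖ ≤ L ‖y‖`. -/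
structure Coercive (A : Vec d →L[ℝ] Vec d) (μ L : ℝ) : Prop where
  lower : ∀ y, μ * ‖y‖ ^ 2 ≤ inner ℝ y (A y)
  upper : ∀ y, ‖A y‖ ≤ L * ‖y‖

theorem mul_norm_le_of_mul_sq_le_inner {μ : ℝ} {y z : Vec d}
    (h : μ * ‖y‖ ^ 2 ≤ inner ℝ y z) : μ * ‖y‖ ≤ ‖z‖ := by
  rcases (norm_nonneg y).eq_or_lt with h0 | h0
  · rw [← h0]; simp
  · have := h.trans (real_inner_le_norm y z)
    refine le_of_mul_le_mul_left ?_ h0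
    linarith [this, sq ‖y‖]

theorem Coercive.norm_lower {A : Vec d →L[ℝ] Vec d} {μ L : ℝ} (hA : Coercive A μ L) (y : Vec d) :
    μ * ‖y‖ ≤ ‖A y‖ := mul_norm_le_of_mul_sq_le_inner (hA.lower y)

theorem Coercive.surjective {A : Vec d →L[ℝ] Vec d} {μ L : ℝ} (hA : Coercive A μ L)
    (hμ : 0 < μ) : Function.Surjective A := by
  refine LinearMap.surjective_of_injective (f := (A : Vec d →ₗ[ℝ] Vec d)) ?_
  rw [← LinearMap.ker_eq_bot, LinearMap.ker_eq_bot']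
  intro y hy
  have h1 := hA.norm_lower y
  have h2 : A y = 0 := hy
  rw [h2, norm_zero] at h1
  have : ‖y‖ ≤ 0 := nonpos_of_mul_nonpos_right h1 hμ
  exact norm_le_zero_iff.1 this

/-! ### Krylov subspaces and polynomial minima -/

theorem krylov_mono (A : Vec d →L[ℝ] Vec d) (v : Vec d) {n n' : ℕ} (h : n ≤ n') :
    krylov A n v ≤ krylov A n' v := by
  refine Submodule.span_mono ?_
  rintro _ ⟨i, rfl⟩
  exact ⟨⟨i, i.2.trans_le h⟩, rfl⟩

theorem map_mem_krylov_succ (A : Vec d →L[ℝ] Vec d) (v : Vec d) {n : ℕ} {z : Vec d}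
    (hz : z ∈ krylov A n v) : A z ∈ krylov A (n + 1) v := by
  induction hz using Submodule.span_induction with
  | mem x hx =>
    obtain ⟨i, rfl⟩ := hx
    refine Submodule.subset_span ⟨⟨i + 1, by omega⟩, ?_⟩
    simp [pow_succ']
  | zero => simp
  | add x y _ _ hx hy => rw [map_add]; exact add_mem hx hy
  | smul a x _ hx => rw [map_smul]; exact Submodule.smul_mem _ _ hx

theorem self_mem_krylov_succ (A : Vec d →L[ℝ] Vec d) (v : Vec d) (n : ℕ) :
    v ∈ krylov A (n + 1) v :=
  Submodule.subset_span ⟨⟨0, by omega⟩, by simp⟩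

theorem finrank_krylov_le (A : Vec d →L[ℝ] Vec d) (v : Vec d) (n : ℕ) :
    Module.finrank ℝ (krylov A n v) ≤ n := by
  exact (finrank_range_le_card (R := ℝ) (fun i : Fin n => (A ^ (i : ℕ)) v)).trans_eq
    (Fintype.card_fin n)

theorem krylov_neg (A : Vec d →L[ℝ] Vec d) (v : Vec d) (n : ℕ) :
    krylov A n (-v) = krylov A n v := by
  apply le_antisymm
  · refine Submodule.span_le.2 ?_
    rintro _ ⟨i, rfl⟩
    change (A ^ (i : ℕ)) (-v) ∈ krylov A n v
    rw [map_neg]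
    exact neg_mem (Submodule.subset_span ⟨i, rfl⟩)
  · refine Submodule.span_le.2 ?_
    rintro _ ⟨i, rfl⟩
    change (A ^ (i : ℕ)) v ∈ krylov A n (-v)
    rw [← neg_neg v, map_neg]
    refine neg_mem (Submodule.subset_span ⟨i, ?_⟩)
    simp

/-- Needed for Type-I, where the residual is close to `-A (x s - xs)` while the minimum is taken
over polynomials applied to `x s - xs`. -/
theorem krylov_map_eq (A : Vec d →L[ℝ] Vec d) (v : Vec d) (n : ℕ) :
    krylov A n (A v) = (krylov A n v).map (A : Vec d →ₗ[ℝ] Vec d) := by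
  rw [krylov, krylov, Submodule.map_span, ← Set.range_comp]
  congr 2
  ext1 i
  change (A ^ (i : ℕ) * A) v = (A * A ^ (i : ℕ)) v
  rw [← pow_succ, ← pow_succ']

theorem aeval_apply_eq_add (A : Vec d →L[ℝ] Vec d) (u : Vec d) (p q : Polynomial ℝ)
    (hp : p = Polynomial.X * q + 1) :
    Polynomial.aeval A p u = u + A (Polynomial.aeval A q u) := by
  rw [hp]
  simp [add_comm]

theorem aeval_mem_krylov (A : Vec d →L[ℝ] Vec d) (u : Vec d) (q : Polynomial ℝ) (n : ℕ)
    (hq : q.degree < n) : Polynomial.aeval A q u ∈ krylov A n u := by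
  by_cases h0 : q = 0
  · simp [h0]
  rw [Polynomial.aeval_eq_sum_range' ((Polynomial.natDegree_lt_iff_degree_lt h0).2 hq), sum_apply]
  refine Submodule.sum_mem _ fun i hi => ?_
  exact Submodule.smul_mem _ _ (Submodule.subset_span ⟨⟨i, Finset.mem_range.1 hi⟩, rfl⟩)

theorem exists_aeval_of_mem_krylov (A : Vec d →L[ℝ] Vec d) (u z : Vec d) (n : ℕ)
    (hz : z ∈ krylov A n u) : ∃ q : Polynomial ℝ, q.degree < n ∧ Polynomial.aeval A q u = z := by
  induction hz using Submodule.span_induction with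
  | mem x hx =>
    obtain ⟨i, rfl⟩ := hx
    refine ⟨Polynomial.X ^ (i : ℕ), ?_, by simp⟩
    rw [Polynomial.degree_X_pow]
    exact_mod_cast i.2
  | zero => exact ⟨0, by simp [bot_lt_iff_ne_bot], by simp⟩
  | add x y _ _ hx hy =>
    obtain ⟨q1, h1, h1'⟩ := hx
    obtain ⟨q2, h2, h2'⟩ := hy
    exact ⟨q1 + q2, (Polynomial.degree_add_le _ _).trans_lt (max_lt h1 h2), by simp [h1', h2']⟩
  | smul a x _ hx =>
    obtain ⟨q, h1, h1'⟩ := hx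
    exact ⟨a • q, (Polynomial.degree_smul_le _ _).trans_lt h1, by simp [h1']⟩

/-- A polynomial with `p(0) = 1` is `X q + 1` with `q` of degree below `n`, and the vectors `q(A) u`
fill the Krylov space. The minimum over polynomials thus becomes a distance to a subspace. -/
theorem mem_polyValues_iff (A : Vec d →L[ℝ] Vec d) (n : ℕ) (u : Vec d) (t : ℝ) :
    t ∈ polyValues A n u ↔ ∃ z ∈ krylov A n u, t = ‖u + A z‖ := by
  constructor
  · rintro ⟨p, hdeg, h0, rfl⟩
    have hp : p = Polynomial.X * p.divX + 1 := by
      conv_lhs => rw [← Polynomial.X_mul_divX_add p]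
      rw [Polynomial.coeff_zero_eq_eval_zero, h0, Polynomial.C_1]
    refine ⟨Polynomial.aeval A p.divX u, aeval_mem_krylov A u _ n ?_, ?_⟩
    · by_cases hd : p.divX = 0
      · rw [hd]; simp [bot_lt_iff_ne_bot]
      · rw [← Polynomial.natDegree_lt_iff_degree_lt hd]
        have h1 : p.natDegree ≠ 0 := by
          intro h
          apply hd
          rw [Polynomial.divX_eq_zero_iff]
          exact Polynomial.eq_C_of_natDegree_eq_zero h
        rw [Polynomial.natDegree_divX_eq_natDegree_tsub_one]
        omega
    · rw [aeval_apply_eq_add A u p _ hp]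
  · rintro ⟨z, hz, rfl⟩
    obtain ⟨q, hq, rfl⟩ := exists_aeval_of_mem_krylov A u z n hz
    refine ⟨Polynomial.X * q + 1, ?_, by simp, by rw [aeval_apply_eq_add A u _ q rfl]⟩
    by_cases hd : q = 0
    · simp [hd]
    · have h1 := (Polynomial.natDegree_lt_iff_degree_lt hd).2 hq
      refine (Polynomial.natDegree_add_le _ _).trans ?_
      rw [Polynomial.natDegree_X_mul hd, Polynomial.natDegree_one]
      omega

/-- The minimum is the distance from `u` to the image of the Krylov space under `A`, attained at the
orthogonal projection. -/
theorem exists_isLeast_polyValues (A : Vec d →L[ℝ] Vec d) (n : ℕ) (u : Vec d) :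
    ∃ z ∈ krylov A n u, IsLeast (polyValues A n u) ‖u + A z‖ := by
  set W := (krylov A n u).map (A : Vec d →ₗ[ℝ] Vec d) with hW
  obtain ⟨z, hz, hz'⟩ : -(W.starProjection u) ∈ W :=
    neg_mem (Submodule.starProjection_apply_mem W u)
  have hz1 : A z = -(W.starProjection u) := hz'
  refine ⟨z, hz, (mem_polyValues_iff A n u _).2 ⟨z, hz, rfl⟩, ?_⟩
  intro t ht
  obtain ⟨y, hy, rfl⟩ := (mem_polyValues_iff A n u _).1 ht
  rw [hz1, ← sub_eq_add_neg, Submodule.starProjection_minimal]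
  have hy' : -(A y) ∈ W := neg_mem ⟨y, hy, rfl⟩
  have := ciInf_le (f := fun x : W => ‖u - x‖) ⟨0, by rintro _ ⟨x, rfl⟩; positivity⟩ ⟨_, hy'⟩
  simpa using this

/-! ### The mixing factor, compressions and Galerkin quasi-optimality -/

theorem theta_le {A : Vec d →L[ℝ] Vec d} {μ L : ℝ} (hA : Coercive A μ L) (hL : 0 ≤ L) {b β' : ℝ}
    (hb : 0 ≤ b) (hb' : b ≤ β') : theta A b ≤ 1 + β' * L := by
  refine ContinuousLinearMap.opNorm_le_bound _ (by have := hb.trans hb'; positivity) fun y => ?_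
  change ‖y - b • A y‖ ≤ _
  calc ‖y - b • A y‖ ≤ ‖y‖ + ‖b • A y‖ := norm_sub_le _ _
    _ ≤ ‖y‖ + β' * (L * ‖y‖) := by
      rw [norm_smul, Real.norm_of_nonneg hb]
      gcongr
      · exact hb.trans hb'
      · exact hA.upper y
    _ = _ := by ring

theorem norm_sub_smul_le_theta (A : Vec d →L[ℝ] Vec d) (b : ℝ) (y : Vec d) :
    ‖y - b • A y‖ ≤ theta A b * ‖y‖ :=
  (ContinuousLinearMap.id ℝ (Vec d) - b • A).le_opNorm y

theorem gam_le {A : Vec d →L[ℝ] Vec d} {μ L : ℝ} (hA : Coercive A μ L) (hL : 0 ≤ L)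
    (W : Submodule ℝ (Vec d)) : gam A W ≤ L := by
  refine ContinuousLinearMap.opNorm_le_bound _ hL fun y => ?_
  change ‖W.starProjection (A (y - W.starProjection y))‖ ≤ L * ‖y‖
  refine (W.norm_starProjection_apply_le _).trans ((hA.upper _).trans ?_)
  gcongr
  rw [← Submodule.starProjection_orthogonal_val]
  exact Submodule.norm_starProjection_apply_le _ _

theorem compression_coe (A : Vec d →L[ℝ] Vec d) (W : Submodule ℝ (Vec d)) (w : W) :
    (compression A W w : Vec d) = W.starProjection (A w) := by
  change W.starProjection (A (W.starProjection w)) = _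
  rw [Submodule.starProjection_mem_subspace_eq_self]

/-- Testing against a vector of `W` does not see the projector, so coercivity passes to the
compression. -/
theorem compression_lower {A : Vec d →L[ℝ] Vec d} {μ L : ℝ} (hA : Coercive A μ L)
    (W : Submodule ℝ (Vec d)) (w : W) : μ * ‖w‖ ≤ ‖compression A W w‖ := by
  have h : μ * ‖(w : Vec d)‖ ^ 2 ≤ inner ℝ (w : Vec d) (compression A W w : Vec d) := by
    rw [compression_coe, ← Submodule.inner_starProjection_left_eq_right,
      Submodule.starProjection_mem_subspace_eq_self]
    exact hA.lower _
  exact mul_norm_le_of_mul_sq_le_inner h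

theorem compression_isInvertible {A : Vec d →L[ℝ] Vec d} {μ L : ℝ} (hA : Coercive A μ L)
    (hμ : 0 < μ) (W : Submodule ℝ (Vec d)) : (compression A W).IsInvertible := by
  have hinj : Function.Injective (compression A W : W →ₗ[ℝ] W) := by
    rw [← LinearMap.ker_eq_bot, LinearMap.ker_eq_bot']
    intro y hy
    have h1 := compression_lower hA W y
    have h2 : compression A W y = 0 := hy
    rw [h2, norm_zero] at h1
    exact norm_le_zero_iff.1 (nonpos_of_mul_nonpos_right h1 hμ)
  let e := (LinearEquiv.ofInjectiveEndo _ hinj).toContinuousLinearEquiv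
  exact ⟨e, by ext x; rfl⟩

theorem kap_le {A : Vec d →L[ℝ] Vec d} {μ L : ℝ} (hA : Coercive A μ L)
    (hμ : 0 < μ) (W : Submodule ℝ (Vec d)) : kap A W ≤ 1 / μ := by
  refine ContinuousLinearMap.opNorm_le_bound _ (by positivity) fun y => ?_
  have h1 := compression_lower hA W ((compression A W).inverse y)
  rw [(compression_isInvertible hA hμ W).self_apply_inverse] at h1
  rw [div_mul_eq_mul_div, one_mul, le_div_iff₀ hμ]
  linarith

/-- With `π` the projector onto `W`, the part `t = (I - π) u` equals `(I - π) a`, hence is at most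
`‖a‖`. Since `π A π u = π A u - π A (I - π) t`, inverting the compression gives `‖π u‖ ≤ κ (ε + γ
‖t‖)`, and Pythagoras combines the two parts. -/
theorem norm_le_of_galerkin {A : Vec d →L[ℝ] Vec d} {μ L : ℝ} (hA : Coercive A μ L)
    (hμ : 0 < μ) (W : Submodule ℝ (Vec d)) {u a : Vec d} {ε : ℝ} (hε : 0 ≤ ε)
    (hua : u - a ∈ W) (hu : ‖W.starProjection (A u)‖ ≤ ε) :
    ‖u‖ ≤ Real.sqrt (1 + gam A W ^ 2 * kap A W ^ 2) * ‖a‖ + kap A W * ε := by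
  have hk0 : 0 ≤ kap A W := by unfold kap; positivity
  have hg0 : 0 ≤ gam A W := by unfold gam; positivity
  set πu : W := W.orthogonalProjectionOnto u with hπ
  have hcu : (πu : Vec d) = W.starProjection u := rfl
  set t := u - W.starProjection u with ht
  have hta : t = a - W.starProjection a := by
    have := Submodule.starProjection_eq_self_iff.2 hua
    rw [map_sub] at this
    rw [ht]
    have h2 : W.starProjection u = u - a + W.starProjection a := by rw [← this]; abel
    rw [h2]; abel
  have htn : ‖t‖ ≤ ‖a‖ := by
    rw [hta, ← Submodule.starProjection_orthogonal_val]
    exact Submodule.norm_starProjection_apply_le _ _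
  have h1 : ‖compression A W πu‖ ≤ ε + gam A W * ‖t‖ := by
    have e : (compression A W πu : Vec d) = W.starProjection (A u) -
        (W.starProjection ∘L A ∘L (ContinuousLinearMap.id ℝ (Vec d) - W.starProjection)) u := by
      rw [compression_coe, hcu]
      simp
    have e2 : (W.starProjection ∘L A ∘L (ContinuousLinearMap.id ℝ (Vec d) - W.starProjection)) u
        = (W.starProjection ∘L A ∘L (ContinuousLinearMap.id ℝ (Vec d) - W.starProjection)) t := by
      have : W.starProjection (W.starProjection u) = W.starProjection u :=
        Submodule.starProjection_eq_self_iff.2 (Submodule.starProjection_apply_mem W u)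
      simp [ht, map_sub, this]
    change ‖(compression A W πu : Vec d)‖ ≤ _
    rw [e, e2]
    exact (norm_sub_le _ _).trans (add_le_add hu (ContinuousLinearMap.le_opNorm _ _))
  have h2 : ‖W.starProjection u‖ ≤ kap A W * ε + kap A W * gam A W * ‖t‖ := by
    have h3 := (compression A W).inverse.le_opNorm (compression A W πu)
    rw [(compression_isInvertible hA hμ W).inverse_apply_self] at h3
    calc ‖W.starProjection u‖ = ‖πu‖ := rfl
      _ ≤ kap A W * ‖compression A W πu‖ := h3
      _ ≤ kap A W * (ε + gam A W * ‖t‖) := by gcongr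
      _ = _ := by ring
  set y : Vec d := W.starProjection u
  have hsplit : ‖u‖ ^ 2 = ‖y‖ ^ 2 + ‖t‖ ^ 2 := by
    rw [Submodule.norm_sq_eq_add_norm_sq_starProjection u W,
      Submodule.starProjection_orthogonal_val]
  set s := Real.sqrt (1 + gam A W ^ 2 * kap A W ^ 2) with hs
  have hs2 : s ^ 2 = 1 + gam A W ^ 2 * kap A W ^ 2 := Real.sq_sqrt (by positivity)
  have hs0 : 0 ≤ s := Real.sqrt_nonneg _
  -- This absorbs the cross term when the sum of squares is compared with `(s ‖t‖ + κ ε) ^ 2`.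
  have hsgk : kap A W * gam A W ≤ s := by
    refine Real.le_sqrt_of_sq_le ?_
    nlinarith
  have hmain : ‖u‖ ≤ s * ‖t‖ + kap A W * ε := by
    refine le_of_sq_le_sq ?_ (by positivity)
    have hy2 : ‖y‖ ^ 2 ≤ (kap A W * ε + kap A W * gam A W * ‖t‖) ^ 2 := by gcongr
    have hc : (kap A W * gam A W) * (kap A W * ε * ‖t‖) ≤ s * (kap A W * ε * ‖t‖) := by gcongr
    calc ‖u‖ ^ 2 ≤ (kap A W * ε + kap A W * gam A W * ‖t‖) ^ 2 + ‖t‖ ^ 2 := by linarith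
      _ = (1 + gam A W ^ 2 * kap A W ^ 2) * ‖t‖ ^ 2 + (kap A W * ε) ^ 2
          + 2 * ((kap A W * gam A W) * (kap A W * ε * ‖t‖)) := by ring
      _ ≤ s ^ 2 * ‖t‖ ^ 2 + (kap A W * ε) ^ 2 + 2 * (s * (kap A W * ε * ‖t‖)) := by
          rw [hs2]; linarith
      _ = _ := by ring
  exact hmain.trans (by gcongr)

/-! ### One cycle without restart: data and approximate pairs -/

/-- The parameters on which the constants of the error bounds depend. -/
structure Params where
  τ : ℝ
  η : ℝ
  β : ℝ
  β' : ℝ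
  μ : ℝ
  L : ℝ
  τ_pos : 0 < τ
  η_pos : 0 < η
  β_pos : 0 < β
  β'_pos : 0 < β'
  μ_pos : 0 < μ
  L_pos : 0 < L

/-- The steps `s, …, s + n` of a run, without a restart after step `s`, for a residual `r` that is
close to the affine map `x ↦ -A (x - xs)`. -/
structure Cycle (P : Params) (ty : AMType) (A : Vec d →L[ℝ] Vec d) (xs : Vec d) (κ : ℝ)
    (x r p q : ℕ → Vec d) (b : ℕ → ℝ) (s n : ℕ) : Prop where
  coercive : Coercive A P.μ P.L
  kappa_nonneg : 0 ≤ κ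
  b_mem : ∀ j, b j ∈ Set.Icc P.β P.β'
  newPair : ∀ j < n, (p (s + (j + 1)), q (s + (j + 1))) =
    sweep ty p q s (x (s + (j + 1)) - x (s + j), r (s + (j + 1)) - r (s + j)) j
  test : ∀ j < n, P.τ * |inner ℝ (vVec ty p q (s + 1)) (q (s + 1))| ≤
    |inner ℝ (vVec ty p q (s + (j + 1))) (q (s + (j + 1)))|
  update : ∀ j ≤ n, x (s + (j + 1)) = (sweep ty p q s (x (s + j), r (s + j)) j).1 +
    b (s + j) • (sweep ty p q s (x (s + j), r (s + j)) j).2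
  res_le : ∀ j ≤ n, ‖r (s + j)‖ ≤ (1 + P.η) * ‖r s‖
  res_lower : ∀ j ≤ n, P.μ * ‖x (s + j) - xs‖ ≤ ‖r (s + j)‖
  res_upper : ‖r s‖ ≤ P.L * ‖x s - xs‖
  lin : ∀ j ≤ n, ‖r (s + j) + A (x (s + j) - xs)‖ ≤ 1 / 2 * κ * ‖x (s + j) - xs‖ ^ 2
  mono : 0 < n → P.μ * ‖x (s + 1) - x s‖ ^ 2 ≤ inner ℝ (x (s + 1) - x s) (-(r (s + 1) - r s))

/-- Bounds for the directions of a cycle, of size `E`. -/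
structure Frame (ty : AMType) (p q : ℕ → Vec d) (s n : ℕ) (a c D B E : ℝ) : Prop where
  pos : 0 < E
  p_le : ∀ i < n, ‖p (s + (i + 1))‖ ≤ a * E
  q_le : ∀ i < n, ‖q (s + (i + 1))‖ ≤ a * E
  lower : ∀ i < n, c * E ^ 2 ≤ |inner ℝ (vVec ty p q (s + (i + 1))) (q (s + (i + 1)))|
  orth : ∀ j < n, ∀ i < j, inner ℝ (vVec ty p q (s + (i + 1))) (q (s + (j + 1))) = 0
  sweep_eq : ∀ j ≤ n, ∀ y : Vec d × Vec d, ∃ ζ : ℕ → ℝ, (∀ i < j, |ζ i| * E ≤ D * ‖y.2‖) ∧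
    sweep ty p q s y j = (y.1 - ∑ i ∈ Finset.range j, ζ i • p (s + (i + 1)),
      y.2 - ∑ i ∈ Finset.range j, ζ i • q (s + (i + 1)))
  coeff : ∀ ζ : ℕ → ℝ, ∀ i < n,
    |ζ i| * E ≤ B * ‖∑ j ∈ Finset.range n, ζ j • q (s + (j + 1))‖

theorem norm_sub_sum_smul_le {v : Vec d} {f : ℕ → Vec d} {ζ : ℕ → ℝ} {n : ℕ} {B ε : ℝ}
    (hB : 0 ≤ B) (hζ : ∀ i < n, |ζ i| ≤ B) (hf : ∀ i < n, ‖f i‖ ≤ ε) :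
    ‖v - ∑ i ∈ Finset.range n, ζ i • f i‖ ≤ ‖v‖ + n * B * ε := by
  refine (norm_sub_le _ _).trans (add_le_add le_rfl ?_)
  calc ‖∑ i ∈ Finset.range n, ζ i • f i‖ ≤ ∑ i ∈ Finset.range n, B * ε := by
        refine norm_sum_le_of_le _ fun i hi => ?_
        have hi' := Finset.mem_range.1 hi
        rw [norm_smul, Real.norm_eq_abs]
        exact mul_le_mul (hζ i hi') (hf i hi') (norm_nonneg _) hB
    _ = _ := by rw [Finset.sum_const, Finset.card_range, nsmul_eq_mul]; ring

/-- The pair `y` is `ε`-close to a pair `(z, -A z)` with `z ∈ K`. -/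
def NearPair (A : Vec d →L[ℝ] Vec d) (K : Submodule ℝ (Vec d)) (ε : ℝ) (y : Vec d × Vec d) :
    Prop :=
  ∃ z ∈ K, ‖y.1 - z‖ ≤ ε ∧ ‖y.2 + A z‖ ≤ ε

theorem NearPair.mono {A : Vec d →L[ℝ] Vec d} {K K' : Submodule ℝ (Vec d)} {ε ε' : ℝ}
    {y : Vec d × Vec d} (h : NearPair A K ε y) (hK : K ≤ K') (hε : ε ≤ ε') :
    NearPair A K' ε' y := by
  obtain ⟨z, hz, h1, h2⟩ := h
  exact ⟨z, hK hz, h1.trans hε, h2.trans hε⟩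

theorem NearPair.sub {A : Vec d →L[ℝ] Vec d} {K : Submodule ℝ (Vec d)} {ε ε' : ℝ}
    {y y' : Vec d × Vec d} (h : NearPair A K ε y) (h' : NearPair A K ε' y') :
    NearPair A K (ε + ε') (y - y') := by
  obtain ⟨z, hz, h1, h2⟩ := h
  obtain ⟨z', hz', h1', h2'⟩ := h'
  refine ⟨z - z', sub_mem hz hz', ?_, ?_⟩
  · have : (y - y').1 - (z - z') = (y.1 - z) - (y'.1 - z') := by simp; abel
    rw [this]
    exact (norm_sub_le _ _).trans (add_le_add h1 h1')
  · have : (y - y').2 + A (z - z') = (y.2 + A z) - (y'.2 + A z') := by simp; abel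
    rw [this]
    exact (norm_sub_le _ _).trans (add_le_add h2 h2')

theorem NearPair.sub_sum {A : Vec d →L[ℝ] Vec d} {K : Submodule ℝ (Vec d)} {ε ε' B : ℝ} {n : ℕ}
    {y : Vec d × Vec d} {p q : ℕ → Vec d} {ζ : ℕ → ℝ} (hB : 0 ≤ B)
    (h : NearPair A K ε y) (hpq : ∀ i < n, NearPair A K ε' (p i, q i))
    (hζ : ∀ i < n, |ζ i| ≤ B) :
    NearPair A K (ε + n * B * ε') (y.1 - ∑ i ∈ Finset.range n, ζ i • p i,
      y.2 - ∑ i ∈ Finset.range n, ζ i • q i) := by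
  obtain ⟨z, hz, h1, h2⟩ := h
  have : ∀ i, ∃ z, i < n → z ∈ K ∧ ‖p i - z‖ ≤ ε' ∧ ‖q i + A z‖ ≤ ε' := by
    intro i
    by_cases hi : i < n
    · obtain ⟨z, h⟩ := hpq i hi
      exact ⟨z, fun _ => h⟩
    · exact ⟨0, fun h => absurd h hi⟩
  choose zz hzz using this
  refine ⟨z - ∑ i ∈ Finset.range n, ζ i • zz i, sub_mem hz (Submodule.sum_mem _ fun i hi =>
    Submodule.smul_mem _ _ (hzz i (Finset.mem_range.1 hi)).1), ?_, ?_⟩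
  · have e : (y.1 - ∑ i ∈ Finset.range n, ζ i • p i) - (z - ∑ i ∈ Finset.range n, ζ i • zz i)
        = (y.1 - z) - ∑ i ∈ Finset.range n, ζ i • (p i - zz i) := by
      simp only [smul_sub, Finset.sum_sub_distrib]; abel
    change ‖(y.1 - ∑ i ∈ Finset.range n, ζ i • p i) - (z - ∑ i ∈ Finset.range n, ζ i • zz i)‖ ≤ _
    rw [e]
    exact (norm_sub_sum_smul_le hB hζ fun i hi => (hzz i hi).2.1).trans (by gcongr)
  · have e : (y.2 - ∑ i ∈ Finset.range n, ζ i • q i) + A (z - ∑ i ∈ Finset.range n, ζ i • zz i)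
        = (y.2 + A z) - ∑ i ∈ Finset.range n, ζ i • (q i + A (zz i)) := by
      simp only [smul_add, Finset.sum_add_distrib, map_sub, map_sum, map_smul]; abel
    change ‖(y.2 - ∑ i ∈ Finset.range n, ζ i • q i) + A (z - ∑ i ∈ Finset.range n, ζ i • zz i)‖ ≤ _
    rw [e]
    exact (norm_sub_sum_smul_le hB hζ fun i hi => (hzz i hi).2.2).trans (by gcongr)

/-! ### Uniform bounds for the directions of a cycle -/

namespace Cycle

variable {P : Params} {ty : AMType} {A : Vec d →L[ℝ] Vec d} {xs : Vec d} {κ : ℝ}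
  {x r p q : ℕ → Vec d} {b : ℕ → ℝ} {s n : ℕ}

theorem norm_res_le (h : Cycle P ty A xs κ x r p q b s n) {j : ℕ} (hj : j ≤ n) :
    ‖r (s + j)‖ ≤ (1 + P.η) * P.L * ‖x s - xs‖ := by
  have h1 := P.η_pos
  calc ‖r (s + j)‖ ≤ (1 + P.η) * ‖r s‖ := h.res_le j hj
    _ ≤ (1 + P.η) * (P.L * ‖x s - xs‖) := by gcongr; exact h.res_upper
    _ = _ := by ring

theorem norm_err_le (h : Cycle P ty A xs κ x r p q b s n) {j : ℕ} (hj : j ≤ n) :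
    ‖x (s + j) - xs‖ ≤ (1 + P.η) * P.L / P.μ * ‖x s - xs‖ := by
  have h1 := (h.res_lower j hj).trans (h.norm_res_le hj)
  rw [div_mul_eq_mul_div, le_div_iff₀ P.μ_pos]
  linarith

theorem norm_lin_le (h : Cycle P ty A xs κ x r p q b s n) {j : ℕ} (hj : j ≤ n) :
    ‖r (s + j) + A (x (s + j) - xs)‖ ≤
      1 / 2 * ((1 + P.η) * P.L / P.μ) ^ 2 * (κ * ‖x s - xs‖ ^ 2) := by
  have hk := h.kappa_nonneg
  calc _ ≤ 1 / 2 * κ * ‖x (s + j) - xs‖ ^ 2 := h.lin j hj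
    _ ≤ 1 / 2 * κ * ((1 + P.η) * P.L / P.μ * ‖x s - xs‖) ^ 2 := by gcongr; exact h.norm_err_le hj
    _ = _ := by ring

/-- The restart test reduces everything to the first direction `p = b_s r_s`, of norm at least `β μ
E`. Monotonicity gives `-pᵀ q ≥ μ ‖p‖²` for Type-I and `‖q‖ ≥ μ ‖p‖` for Type-II; the minimum of `μ`
and `μ ^ 2` serves both. -/
theorem dirs_lower (h : Cycle P ty A xs κ x r p q b s n) {j : ℕ} (hj : j < n) :
    P.τ * (min P.μ (P.μ ^ 2) * (P.β ^ 2 * P.μ ^ 2)) * ‖x s - xs‖ ^ 2 ≤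
      |inner ℝ (vVec ty p q (s + (j + 1))) (q (s + (j + 1)))| := by
  have hμ := P.μ_pos
  have hβ := P.β_pos
  have hτ := P.τ_pos
  refine le_trans ?_ (h.test j hj)
  rw [mul_assoc]
  refine mul_le_mul_of_nonneg_left ?_ hτ.le
  have hn : 0 < n := by omega
  have h1 := h.newPair 0 hn
  have h2 := h.update 0 (Nat.zero_le _)
  simp only [zero_add, add_zero, sweep, Prod.mk.injEq] at h1 h2
  have hb := h.b_mem s
  have hp : P.β * (P.μ * ‖x s - xs‖) ≤ ‖p (s + 1)‖ := by
    rw [h1.1, h2, add_sub_cancel_left, norm_smul, Real.norm_of_nonneg (hβ.le.trans hb.1)]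
    exact mul_le_mul hb.1 (h.res_lower 0 (Nat.zero_le _)) (by positivity) (hβ.le.trans hb.1)
  have hm := h.mono hn
  rw [← h1.1, ← h1.2] at hm
  have hp2 : P.β ^ 2 * P.μ ^ 2 * ‖x s - xs‖ ^ 2 ≤ ‖p (s + 1)‖ ^ 2 := by
    rw [← mul_pow, ← mul_pow, mul_assoc]; gcongr
  have hmin : 0 < min P.μ (P.μ ^ 2) := by positivity
  rw [mul_assoc]
  cases ty
  · change _ ≤ |inner ℝ (p (s + 1)) (q (s + 1))|
    calc min P.μ (P.μ ^ 2) * (P.β ^ 2 * P.μ ^ 2 * ‖x s - xs‖ ^ 2)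
        ≤ P.μ * ‖p (s + 1)‖ ^ 2 := by gcongr; exact min_le_left _ _
      _ ≤ inner ℝ (p (s + 1)) (-(q (s + 1))) := hm
      _ ≤ |inner ℝ (p (s + 1)) (-(q (s + 1)))| := le_abs_self _
      _ = _ := by rw [inner_neg_right, abs_neg]
  · change _ ≤ |inner ℝ (q (s + 1)) (q (s + 1))|
    have h3 := mul_norm_le_of_mul_sq_le_inner hm
    rw [norm_neg] at h3
    rw [real_inner_self_eq_norm_sq, abs_of_nonneg (by positivity)]
    calc min P.μ (P.μ ^ 2) * (P.β ^ 2 * P.μ ^ 2 * ‖x s - xs‖ ^ 2)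
        ≤ P.μ ^ 2 * ‖p (s + 1)‖ ^ 2 := by gcongr; exact min_le_right _ _
      _ = (P.μ * ‖p (s + 1)‖) ^ 2 := by ring
      _ ≤ _ := by gcongr

end Cycle

/-- Bounding the coefficients that build a direction requires bounds on the earlier directions,
hence the induction, in which the constant grows with the index. -/
theorem Cycle.exists_dirs_bound (P : Params) (N : ℕ) : ∃ a : ℝ, 0 < a ∧
    ∀ (ty : AMType) (A : Vec d →L[ℝ] Vec d) (xs : Vec d) (κ : ℝ) (x r p q : ℕ → Vec d)
      (b : ℕ → ℝ) (s n : ℕ), Cycle P ty A xs κ x r p q b s n → 0 < ‖x s - xs‖ →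
      ∀ j < n, j < N → ‖p (s + (j + 1))‖ ≤ a * ‖x s - xs‖ ∧
        ‖q (s + (j + 1))‖ ≤ a * ‖x s - xs‖ := by
  induction N with
  | zero => exact ⟨1, one_pos, fun _ _ _ _ _ _ _ _ _ _ _ _ _ _ _ h => by omega⟩
  | succ N ih =>
    obtain ⟨a, ha, H⟩ := ih
    have hμ := P.μ_pos
    have hβ := P.β_pos
    have hτ := P.τ_pos
    have hη := P.η_pos
    have hL := P.L_pos
    have hc : 0 < P.τ * (min P.μ (P.μ ^ 2) * (P.β ^ 2 * P.μ ^ 2)) := by positivity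
    obtain ⟨D, hD, HD⟩ := sweep_eq_sum (d := d) ha hc N
    set a0 := (1 + P.η) * P.L / P.μ with ha0
    have ha0' : 0 < a0 := by positivity
    set ρ := (1 + P.η) * P.L with hρ
    have hρ' : 0 < ρ := by positivity
    refine ⟨a + 2 * a0 + 2 * ρ + N * (D * (2 * ρ)) * a, by positivity,
      fun ty A xs κ x r p q b s n hC hE j hj hjN => ?_⟩
    set E := ‖x s - xs‖ with hEdef
    have H' := H ty A xs κ x r p q b s n hC hE
    rcases Nat.lt_or_ge j N with hjN' | hjN'
    · have hle : a * E ≤ (a + 2 * a0 + 2 * ρ + N * (D * (2 * ρ)) * a) * E := by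
        gcongr
        have : 0 ≤ N * (D * (2 * ρ)) * a := by positivity
        linarith
      exact ⟨(H' j hj hjN').1.trans hle, (H' j hj hjN').2.trans hle⟩
    obtain rfl : j = N := by omega
    obtain ⟨ζ, h1, h2⟩ := HD ty p q s E hE j le_rfl (fun i hi => (H' i (by omega) hi).1)
      (fun i hi => (H' i (by omega) hi).2) (fun i hi => hC.dirs_lower (by omega))
      (x (s + (j + 1)) - x (s + j), r (s + (j + 1)) - r (s + j))
    rw [← hC.newPair j hj, Prod.mk.injEq] at h2
    have hr : ‖r (s + (j + 1)) - r (s + j)‖ ≤ 2 * ρ * E := by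
      refine (norm_sub_le _ _).trans ?_
      have h3 := hC.norm_res_le (j := j + 1) (by omega)
      have h4 := hC.norm_res_le (j := j) (by omega)
      linarith
    have hx : ‖x (s + (j + 1)) - x (s + j)‖ ≤ 2 * a0 * E := by
      have : x (s + (j + 1)) - x (s + j) = (x (s + (j + 1)) - xs) - (x (s + j) - xs) := by abel
      rw [this]
      refine (norm_sub_le _ _).trans ?_
      have h3 := hC.norm_err_le (j := j + 1) (by omega)
      have h4 := hC.norm_err_le (j := j) (by omega)
      linarith
    have hζ : ∀ i < j, |ζ i| ≤ D * (2 * ρ) := fun i hi => by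
      refine le_of_mul_le_mul_right ((h1 i hi).trans ?_) hE
      calc D * ‖r (s + (j + 1)) - r (s + j)‖ ≤ D * (2 * ρ * E) := by gcongr
        _ = _ := by ring
    have hB : 0 ≤ D * (2 * ρ) := by positivity
    constructor
    · rw [h2.1]
      refine (norm_sub_sum_smul_le hB hζ fun i hi => (H' i (by omega) hi).1).trans ?_
      nlinarith [mul_pos ha hE, mul_pos hρ' hE]
    · rw [h2.2]
      refine (norm_sub_sum_smul_le hB hζ fun i hi => (H' i (by omega) hi).2).trans ?_
      nlinarith [mul_pos ha hE, mul_pos ha0' hE]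

theorem Cycle.exists_frame (P : Params) (N : ℕ) : ∃ a c D B : ℝ, 0 < a ∧ 0 < c ∧ 0 < D ∧ 0 < B ∧
    ∀ (ty : AMType) (A : Vec d →L[ℝ] Vec d) (xs : Vec d) (κ : ℝ) (x r p q : ℕ → Vec d)
      (b : ℕ → ℝ) (s n : ℕ), Cycle P ty A xs κ x r p q b s n → 0 < ‖x s - xs‖ → n ≤ N →
      Frame ty p q s n a c D B ‖x s - xs‖ := by
  have hμ := P.μ_pos
  have hβ := P.β_pos
  have hτ := P.τ_pos
  have hc : 0 < P.τ * (min P.μ (P.μ ^ 2) * (P.β ^ 2 * P.μ ^ 2)) := by positivity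
  obtain ⟨a, ha, H⟩ := Cycle.exists_dirs_bound (d := d) P N
  obtain ⟨D, hD, HD⟩ := sweep_eq_sum (d := d) ha hc N
  obtain ⟨B, hB, HB⟩ := coeff_bound_of_triangular (d := d) ha hc N
  refine ⟨a, _, D, B, ha, hc, hD, hB, fun ty A xs κ x r p q b s n hC hE hn => ?_⟩
  have H' := H ty A xs κ x r p q b s n hC hE
  have hlow : ∀ i < n, _ := fun i hi => hC.dirs_lower hi
  have horth : ∀ j, j < n → ∀ i < j,
      inner ℝ (vVec ty p q (s + (i + 1))) (q (s + (j + 1))) = 0 := by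
    intro j
    induction j using Nat.strong_induction_on with
    | _ j ih =>
      intro hj i hi
      have h1 := congrArg Prod.snd (hC.newPair j hj)
      simp only at h1
      rw [h1]
      refine sweep_inner_eq_zero ty p q s _ j (fun i hi => ?_)
        (fun j' hj' i hi => ih j' hj' (by omega) i hi) i hi
      rw [← abs_pos]
      exact lt_of_lt_of_le (by positivity) (hlow i (by omega))
  have hp : ∀ i < n, _ := fun i hi => (H' i hi (by omega)).1
  have hq : ∀ i < n, _ := fun i hi => (H' i hi (by omega)).2
  refine ⟨hE, hp, hq, hlow, horth, fun j hj y => ?_, fun ζ i hi => ?_⟩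
  · exact HD ty p q s _ hE j (by omega) (fun i hi => hp i (by omega))
      (fun i hi => hq i (by omega)) (fun i hi => hlow i (by omega)) y
  · refine HB (fun i => vVec ty p q (s + (i + 1))) (fun i => q (s + (i + 1))) n _ hE ?_ hq hlow
      horth ζ i hi (by omega)
    intro i hi
    cases ty
    · exact hp i hi
    · exact hq i hi

/-- The final point of a cycle is controlled by its first point. -/
theorem Cycle.exists_growth (P : Params) (N : ℕ) : ∃ G : ℝ, 0 < G ∧
    ∀ (ty : AMType) (A : Vec d →L[ℝ] Vec d) (xs : Vec d) (κ : ℝ) (x r p q : ℕ → Vec d)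
      (b : ℕ → ℝ) (s n : ℕ), Cycle P ty A xs κ x r p q b s n → n ≤ N →
      ‖x (s + (n + 1)) - xs‖ ≤ G * ‖x s - xs‖ := by
  obtain ⟨a, c, D, B, ha, hc, hD, hB, H⟩ := Cycle.exists_frame (d := d) P N
  have hμ := P.μ_pos
  have hη := P.η_pos
  have hL := P.L_pos
  have hβ' := P.β'_pos
  set a0 := (1 + P.η) * P.L / P.μ with ha0
  have ha0' : 0 < a0 := by positivity
  set ρ := (1 + P.η) * P.L with hρ
  have hρ' : 0 < ρ := by positivity
  refine ⟨(a0 + N * (D * ρ) * a) + P.β' * (ρ + N * (D * ρ) * a), by positivity,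
    fun ty A xs κ x r p q b s n hC hn => ?_⟩
  rcases (norm_nonneg (x s - xs)).eq_or_lt with h0 | hE
  -- At `E = 0` there is no frame, but the residual vanishes and the sweep leaves the solution
  -- unchanged.
  · have h1 := hC.norm_err_le (le_refl n)
    have h2 := hC.norm_res_le (le_refl n)
    rw [← h0, mul_zero] at h1 h2
    have h3 := hC.update n le_rfl
    rw [norm_le_zero_iff.1 h2, sweep_of_snd_eq_zero] at h3
    rw [h3, ← h0]
    simpa using h1
  have F := H ty A xs κ x r p q b s n hC hE hn
  set E := ‖x s - xs‖ with hEdef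
  obtain ⟨ζ, h1, h2⟩ := F.sweep_eq n le_rfl (x (s + n), r (s + n))
  have hr := hC.norm_res_le (le_refl n)
  have hx := hC.norm_err_le (le_refl n)
  have hζ : ∀ i < n, |ζ i| ≤ D * ρ := fun i hi => by
    refine le_of_mul_le_mul_right ((h1 i hi).trans ?_) hE
    calc D * ‖r (s + n)‖ ≤ D * (ρ * E) := by gcongr
      _ = _ := by ring
  have hB' : 0 ≤ D * ρ := by positivity
  have hnN : (n : ℝ) ≤ N := by exact_mod_cast hn
  rw [hC.update n le_rfl, h2]
  have e1 := norm_sub_sum_smul_le (v := x (s + n) - xs) hB' hζ F.p_le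
  have e2 := norm_sub_sum_smul_le (v := r (s + n)) hB' hζ F.q_le
  have hbm := hC.b_mem (s + n)
  have hb0 : 0 ≤ b (s + n) := P.β_pos.le.trans hbm.1
  set S1 := ∑ i ∈ Finset.range n, ζ i • p (s + (i + 1))
  set S2 := ∑ i ∈ Finset.range n, ζ i • q (s + (i + 1))
  have e : x (s + n) - S1 + b (s + n) • (r (s + n) - S2) - xs =
    (x (s + n) - xs - S1) + b (s + n) • (r (s + n) - S2) := by abel
  change ‖x (s + n) - S1 + b (s + n) • (r (s + n) - S2) - xs‖ ≤ _
  rw [e]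
  calc _ ≤ ‖x (s + n) - xs - S1‖ + b (s + n) * ‖r (s + n) - S2‖ := by
        refine (norm_add_le _ _).trans ?_
        rw [norm_smul, Real.norm_of_nonneg hb0]
    _ ≤ (a0 * E + N * (D * ρ) * (a * E)) + P.β' * (ρ * E + N * (D * ρ) * (a * E)) := by
        have hb1 := hbm.2
        refine add_le_add (e1.trans ?_) (mul_le_mul hb1 (e2.trans ?_) (norm_nonneg _) hβ'.le)
        · gcongr
        · gcongr
    _ = _ := by ring

/-! ### Approximation of a cycle by Krylov subspaces -/

/-- The pairs of a cycle are close to the Krylov subspaces generated by any vector `w` close to the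
first residual. -/
theorem Cycle.exists_nearPair_dirs (P : Params) (M N : ℕ) : ∃ C : ℝ, 0 < C ∧
    ∀ (ty : AMType) (A : Vec d →L[ℝ] Vec d) (xs : Vec d) (κ : ℝ) (x r p q : ℕ → Vec d)
      (b : ℕ → ℝ) (s n : ℕ), Cycle P ty A xs κ x r p q b s n → 0 < ‖x s - xs‖ → n ≤ M →
      ∀ w : Vec d, ‖r s - w‖ ≤ κ * ‖x s - xs‖ ^ 2 → ∀ j ≤ n, j ≤ N →
        NearPair A (krylov A j w) (C * (κ * ‖x s - xs‖ ^ 2)) (x (s + j) - x s, r (s + j) - r s) ∧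
        (∀ i < j, NearPair A (krylov A j w) (C * (κ * ‖x s - xs‖ ^ 2))
          (p (s + (i + 1)), q (s + (i + 1)))) ∧
        NearPair A (krylov A j w) (C * (κ * ‖x s - xs‖ ^ 2))
          ((sweep ty p q s (x (s + j), r (s + j)) j).1 - x s,
            (sweep ty p q s (x (s + j), r (s + j)) j).2 - r s) := by
  obtain ⟨a, c, D, B, ha, hc, hD, hB, H⟩ := Cycle.exists_frame (d := d) P M
  have hμ := P.μ_pos
  have hη := P.η_pos
  have hL := P.L_pos
  have hβ' := P.β'_pos
  induction N with
  | zero =>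
    refine ⟨1, one_pos, fun ty A xs κ x r p q b s n hC hE hn w hw j hj hj0 => ?_⟩
    obtain rfl : j = 0 := by omega
    have hk := hC.kappa_nonneg
    have h0 : NearPair A (krylov A 0 w) (1 * (κ * ‖x s - xs‖ ^ 2)) (x s - x s, r s - r s) :=
      ⟨0, zero_mem _, by simp; positivity, by simp; positivity⟩
    exact ⟨h0, fun i hi => by omega, h0⟩
  | succ N ih =>
    obtain ⟨C, hCpos, ih⟩ := ih
    set a0 := (1 + P.η) * P.L / P.μ with ha0
    have ha0' : 0 < a0 := by positivity
    set ρ := (1 + P.η) * P.L with hρ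
    have hρ' : 0 < ρ := by positivity
    -- Error constants, in order: the new point alone, the new point with its residual, the new
    -- direction, the pair after the sweep.
    obtain ⟨C2, hC2⟩ : ∃ C2, C2 = C + P.β' * C + P.β' := ⟨_, rfl⟩
    obtain ⟨C3, hC3⟩ : ∃ C3, C3 = C2 + 1 / 2 * a0 ^ 2 + 1 / 2 * a0 ^ 2 + P.L * C2 := ⟨_, rfl⟩
    obtain ⟨C4, hC4⟩ : ∃ C4, C4 = (C3 + C) + M * (D * (2 * ρ)) * C := ⟨_, rfl⟩
    obtain ⟨C5, hC5⟩ : ∃ C5, C5 = C3 + M * (D * (2 * ρ)) * C4 := ⟨_, rfl⟩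
    have hC2p : 0 < C2 := by rw [hC2]; positivity
    have hC3p : 0 < C3 := by rw [hC3]; positivity
    have hC4p : 0 < C4 := by rw [hC4]; positivity
    have h34 : C3 ≤ C4 := by
      rw [hC4]
      have : 0 ≤ M * (D * (2 * ρ)) * C := by positivity
      linarith
    have hc4 : C ≤ C4 := by
      rw [hC4]
      have : 0 ≤ M * (D * (2 * ρ)) * C := by positivity
      linarith
    have hC5p : 0 < C5 := by rw [hC5]; positivity
    refine ⟨C4 + C5, by positivity, fun ty A xs κ x r p q b s n hC hE hn w hw j hj hjN => ?_⟩
    have hk := hC.kappa_nonneg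
    have F := H ty A xs κ x r p q b s n hC hE hn
    set E := ‖x s - xs‖ with hEdef
    set ε := κ * E ^ 2 with hε
    have hε0 : 0 ≤ ε := by positivity
    have le4 : C4 * ε ≤ (C4 + C5) * ε := by gcongr; linarith
    have le3 : C3 * ε ≤ (C4 + C5) * ε := by gcongr; linarith
    have lec : C * ε ≤ (C4 + C5) * ε := by gcongr; linarith
    have le5 : C5 * ε ≤ (C4 + C5) * ε := by gcongr; linarith
    have ih' := ih ty A xs κ x r p q b s n hC hE hn w hw
    rcases Nat.lt_or_ge N j with hjN' | hjN'
    swap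
    · obtain ⟨h1, h2, h3⟩ := ih' j hj hjN'
      exact ⟨h1.mono le_rfl lec, fun i hi => (h2 i hi).mono le_rfl lec, h3.mono le_rfl lec⟩
    obtain rfl : j = N + 1 := by omega
    clear hjN hjN'
    obtain ⟨hN1, hN2, z, hz, hz1, hz2⟩ := ih' N (by omega) le_rfl
    have hbm := hC.b_mem (s + N)
    have hb0 : 0 ≤ b (s + N) := P.β_pos.le.trans hbm.1
    have hmono : krylov A N w ≤ krylov A (N + 1) w := krylov_mono A w (Nat.le_succ N)
    have hup := hC.update N (by omega)
    set sw := sweep ty p q s (x (s + N), r (s + N)) N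
    simp only at hz1 hz2
    have hNM : (N : ℝ) ≤ M := by exact_mod_cast (by omega : N ≤ M)
    have hN1M : ((N + 1 : ℕ) : ℝ) ≤ M := by exact_mod_cast (by omega : N + 1 ≤ M)
    have hx : NearPair A (krylov A (N + 1) w) (C3 * ε)
        (x (s + (N + 1)) - x s, r (s + (N + 1)) - r s) := by
      -- The mixing step applied to the model pair `(z, w - A z)`. The single application of `A`
      -- raises the Krylov index by one.
      set y := z - b (s + N) • A z + b (s + N) • w with hy
      have hyK : y ∈ krylov A (N + 1) w :=
        add_mem (sub_mem (hmono hz) (Submodule.smul_mem _ _ (map_mem_krylov_succ A w hz)))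
          (Submodule.smul_mem _ _ (self_mem_krylov_succ A w N))
      have h1 : ‖x (s + (N + 1)) - x s - y‖ ≤ C2 * ε := by
        have e : x (s + (N + 1)) - x s - y = (sw.1 - x s - z) + b (s + N) • (sw.2 - r s + A z)
            + b (s + N) • (r s - w) := by
          rw [hup, hy]; simp only [smul_add, smul_sub]; abel
        rw [e]
        calc _ ≤ ‖sw.1 - x s - z‖ + b (s + N) * ‖sw.2 - r s + A z‖ + b (s + N) * ‖r s - w‖ := by
              refine (norm_add₃_le).trans_eq ?_
              rw [norm_smul, norm_smul, Real.norm_of_nonneg hb0]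
          _ ≤ C * ε + P.β' * (C * ε) + P.β' * ε := by
              have := hbm.2
              gcongr
          _ = C2 * ε := by rw [hC2]; ring
      have hlin1 := hC.norm_lin_le hj
      have hlin0 := hC.norm_lin_le (Nat.zero_le n)
      rw [add_zero] at hlin0
      refine ⟨y, hyK, h1.trans ?_, ?_⟩
      · rw [hC3]
        gcongr
        have : 0 ≤ P.L * C2 := by positivity
        have : 0 ≤ 1 / 2 * a0 ^ 2 := by positivity
        linarith
      · have e : r (s + (N + 1)) - r s + A y = (r (s + (N + 1)) + A (x (s + (N + 1)) - xs))
            - (r s + A (x s - xs)) - A (x (s + (N + 1)) - x s - y) := by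
          simp only [map_sub]; abel
        change ‖r (s + (N + 1)) - r s + A y‖ ≤ _
        rw [e]
        refine (norm_sub_le _ _).trans ((add_le_add (norm_sub_le _ _) le_rfl).trans ?_)
        have hA1 := (hC.coercive.upper (x (s + (N + 1)) - x s - y)).trans
          (mul_le_mul_of_nonneg_left h1 hL.le)
        rw [hC3]
        calc _ ≤ 1 / 2 * a0 ^ 2 * ε + 1 / 2 * a0 ^ 2 * ε + P.L * (C2 * ε) :=
              add_le_add (add_le_add hlin1 hlin0) hA1
          _ = (1 / 2 * a0 ^ 2 + 1 / 2 * a0 ^ 2 + P.L * C2) * ε := by ring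
          _ ≤ _ := by gcongr; linarith
    have hr1 := hC.norm_res_le hj
    have hr0 := hC.norm_res_le (show N ≤ n by omega)
    have hraw : NearPair A (krylov A (N + 1) w) (C3 * ε + C * ε)
        (x (s + (N + 1)) - x (s + N), r (s + (N + 1)) - r (s + N)) := by
      have := hx.sub (hN1.mono hmono le_rfl)
      simpa using this
    have hdir : NearPair A (krylov A (N + 1) w) (C4 * ε)
        (p (s + (N + 1)), q (s + (N + 1))) := by
      obtain ⟨ζ, h1, h2⟩ := F.sweep_eq N (by omega)
        (x (s + (N + 1)) - x (s + N), r (s + (N + 1)) - r (s + N))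
      have hrn : ‖r (s + (N + 1)) - r (s + N)‖ ≤ 2 * ρ * E := by
        refine (norm_sub_le _ _).trans ?_
        linarith
      have hζ : ∀ i < N, |ζ i| ≤ D * (2 * ρ) := fun i hi => by
        refine le_of_mul_le_mul_right ((h1 i hi).trans ?_) hE
        calc D * ‖r (s + (N + 1)) - r (s + N)‖ ≤ D * (2 * ρ * E) := by gcongr
          _ = _ := by ring
      rw [hC.newPair N (by omega), h2]
      refine (hraw.sub_sum (by positivity) (fun i hi => (hN2 i hi).mono hmono le_rfl) hζ).mono
        le_rfl ?_
      calc _ ≤ C3 * ε + C * ε + M * (D * (2 * ρ)) * (C * ε) := by gcongr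
        _ = C4 * ε := by rw [hC4]; ring
    have hdirs : ∀ i < N + 1, NearPair A (krylov A (N + 1) w) (C4 * ε)
        (p (s + (i + 1)), q (s + (i + 1))) := by
      intro i hi
      rcases Nat.lt_or_ge i N with h | h
      · exact (hN2 i h).mono hmono (by gcongr)
      · obtain rfl : i = N := by omega
        exact hdir
    refine ⟨hx.mono le_rfl le3, fun i hi => (hdirs i hi).mono le_rfl le4, ?_⟩
    obtain ⟨ζ, h1, h2⟩ := F.sweep_eq (N + 1) hj (x (s + (N + 1)), r (s + (N + 1)))
    have hζ : ∀ i < N + 1, |ζ i| ≤ D * (2 * ρ) := fun i hi => by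
      refine le_of_mul_le_mul_right ((h1 i hi).trans ?_) hE
      calc D * ‖r (s + (N + 1))‖ ≤ D * (2 * ρ * E) := by
            gcongr; linarith [mul_pos hρ' hE]
        _ = _ := by ring
    rw [h2]
    have := (hx.sub_sum (by positivity) hdirs hζ).mono le_rfl (ε' := (C4 + C5) * ε) (by
      calc _ ≤ C3 * ε + M * (D * (2 * ρ)) * (C4 * ε) := by gcongr
        _ = C5 * ε := by rw [hC5]; ring
        _ ≤ _ := le5)
    simp only [sub_right_comm _ (x s), sub_right_comm _ (r s)] at this ⊢
    exact this

/-- Approximations of the directions form a basis of a space of the right dimension, with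
uniformly bounded coordinates. -/
theorem Frame.exists_coeff {ty : AMType} {p q : ℕ → Vec d} {s n : ℕ} {a c D B E : ℝ}
    (F : Frame ty p q s n a c D B E) (hB : 0 < B) {A : Vec d →L[ℝ] Vec d} {μ L : ℝ}
    (hA : Coercive A μ L) {K : Submodule ℝ (Vec d)} (hK : Module.finrank ℝ K ≤ n)
    {z : ℕ → Vec d} (hz : ∀ i < n, z i ∈ K) {ε : ℝ}
    (hzq : ∀ i < n, ‖q (s + (i + 1)) + A (z i)‖ ≤ ε) (hε : 2 * (n * B) * ε ≤ E) :
    Module.finrank ℝ K = n ∧ ∀ y ∈ K, ∃ ζ : ℕ → ℝ, y = ∑ i ∈ Finset.range n, ζ i • z i ∧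
      (∑ i ∈ Finset.range n, |ζ i|) * E ≤ 2 * (n * B) * L * ‖y‖ := by
  have key : ∀ ζ : ℕ → ℝ, (∑ i ∈ Finset.range n, |ζ i|) * E ≤
      2 * (n * B) * L * ‖∑ i ∈ Finset.range n, ζ i • z i‖ := by
    intro ζ
    set S := ∑ i ∈ Finset.range n, |ζ i| with hS
    have hS0 : 0 ≤ S := Finset.sum_nonneg fun i _ => abs_nonneg _
    set y := ∑ i ∈ Finset.range n, ζ i • z i with hy
    have h1 : S * E ≤ n * B * ‖∑ j ∈ Finset.range n, ζ j • q (s + (j + 1))‖ := by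
      rw [hS, Finset.sum_mul]
      refine (Finset.sum_le_sum fun i hi => F.coeff ζ i (Finset.mem_range.1 hi)).trans_eq ?_
      rw [Finset.sum_const, Finset.card_range, nsmul_eq_mul]; ring
    have e : ∑ j ∈ Finset.range n, ζ j • q (s + (j + 1)) =
        (∑ j ∈ Finset.range n, ζ j • (q (s + (j + 1)) + A (z j))) - A y := by
      simp only [hy, smul_add, Finset.sum_add_distrib, map_sum, map_smul]; abel
    have h2 : ‖∑ j ∈ Finset.range n, ζ j • (q (s + (j + 1)) + A (z j))‖ ≤ S * ε := by
      rw [hS, Finset.sum_mul]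
      refine norm_sum_le_of_le _ fun i hi => ?_
      rw [norm_smul, Real.norm_eq_abs]
      exact mul_le_mul_of_nonneg_left (hzq i (Finset.mem_range.1 hi)) (abs_nonneg _)
    have h3 : ‖∑ j ∈ Finset.range n, ζ j • q (s + (j + 1))‖ ≤ S * ε + L * ‖y‖ := by
      rw [e]
      exact (norm_sub_le _ _).trans (add_le_add h2 (hA.upper y))
    have h4 : S * E ≤ n * B * (S * ε + L * ‖y‖) := h1.trans (by gcongr)
    -- The smallness of `ε` lets half of `S * E` absorb the error made in replacing `q` by `-A z`.
    have h5 : S * (2 * (n * B) * ε) ≤ S * E := by gcongr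
    linarith
  have hli : LinearIndependent ℝ (fun i : Fin n => z i) := by
    rw [Fintype.linearIndependent_iff]
    intro g hg i
    have h1 := key (fun j => if h : j < n then g ⟨j, h⟩ else 0)
    have h2 : ∑ i ∈ Finset.range n, (if h : i < n then g ⟨i, h⟩ else 0) • z i = 0 := by
      rw [← hg, Finset.sum_range]
      exact Finset.sum_congr rfl fun i _ => by simp
    rw [h2, norm_zero, mul_zero] at h1
    have h3 := nonpos_of_mul_nonpos_left h1 F.pos
    have h4 := Finset.single_le_sum (f := fun j => |if h : j < n then g ⟨j, h⟩ else 0|)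
      (fun i _ => abs_nonneg _) (Finset.mem_range.2 i.2)
    have h5 : |g i| ≤ 0 := by
      refine le_trans ?_ (h4.trans h3)
      simp
    exact abs_nonpos_iff.1 h5
  have hspan : Submodule.span ℝ (Set.range fun i : Fin n => z i) ≤ K := by
    refine Submodule.span_le.2 ?_
    rintro _ ⟨i, rfl⟩
    exact hz i i.2
  have hfr := finrank_span_eq_card hli
  rw [Fintype.card_fin] at hfr
  -- There are `n` independent vectors in a space of dimension at most `n`.
  have heq : Submodule.span ℝ (Set.range fun i : Fin n => z i) = K :=
    Submodule.eq_of_le_of_finrank_le hspan (by rw [hfr]; exact hK)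
  refine ⟨by rw [← heq, hfr], fun y hy => ?_⟩
  rw [← heq, Submodule.mem_span_range_iff_exists_fun] at hy
  obtain ⟨g, hg⟩ := hy
  have h2 : y = ∑ i ∈ Finset.range n, (if h : i < n then g ⟨i, h⟩ else 0) • z i := by
    rw [← hg, Finset.sum_range]
    exact Finset.sum_congr rfl fun i _ => by simp
  exact ⟨_, h2, (key _).trans_eq (by rw [← h2])⟩

/-- The last step of a cycle of small size `E`, compared with a Krylov subspace: `z` approximates
the directions, `y` the last projected point `X - x s`, and `R` is the last projected residual. -/
structure KrylovFit (A : Vec d →L[ℝ] Vec d) (K : Submodule ℝ (Vec d)) (u₀ r₀ : Vec d)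
    (p q : ℕ → Vec d) (X R : Vec d) (n : ℕ) (C ε E : ℝ) (z : ℕ → Vec d) (y : Vec d) : Prop where
  mem : ∀ i < n, z i ∈ K
  p_near : ∀ i < n, ‖p i - z i‖ ≤ C * ε
  q_near : ∀ i < n, ‖q i + A (z i)‖ ≤ C * ε
  finrank_eq : Module.finrank ℝ K = n
  coeff : ∀ v ∈ K, ∃ ζ : ℕ → ℝ, v = ∑ i ∈ Finset.range n, ζ i • z i ∧
    (∑ i ∈ Finset.range n, |ζ i|) * E ≤ C * ‖v‖
  mem' : y ∈ K
  x_near : ‖X - u₀ - y‖ ≤ C * ε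
  r_near : ‖R + A (u₀ + y)‖ ≤ C * ε
  r_near' : ‖R - r₀ + A y‖ ≤ C * ε
  lin : ‖R + A X‖ ≤ C * ε
  r_le : ‖R‖ ≤ C * E

/-- The vector `w` is left free because Type-I compares the Krylov spaces of `r s` and of `-A (x s -
xs)`, both fitted to the same directions. -/
theorem Cycle.exists_krylovFit (P : Params) (M : ℕ) : ∃ C δ : ℝ, 0 < C ∧ 0 < δ ∧ δ ≤ 1 ∧
    ∀ (ty : AMType) (A : Vec d →L[ℝ] Vec d) (xs : Vec d) (κ : ℝ) (x r p q : ℕ → Vec d)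
      (b : ℕ → ℝ) (s n : ℕ), Cycle P ty A xs κ x r p q b s n → 0 < ‖x s - xs‖ → n ≤ M →
      κ * ‖x s - xs‖ ≤ δ →
      (∀ i < n, inner ℝ (vVec ty p q (s + (i + 1)))
        (sweep ty p q s (x (s + n), r (s + n)) n).2 = 0) ∧
      ∀ w : Vec d, ‖r s - w‖ ≤ κ * ‖x s - xs‖ ^ 2 → ∃ (z : ℕ → Vec d) (y : Vec d),
        KrylovFit A (krylov A n w) (x s - xs) (r s) (fun i => p (s + (i + 1)))
          (fun i => q (s + (i + 1))) ((sweep ty p q s (x (s + n), r (s + n)) n).1 - xs)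
          (sweep ty p q s (x (s + n), r (s + n)) n).2 n C (κ * ‖x s - xs‖ ^ 2) ‖x s - xs‖ z y := by
  obtain ⟨a, c, D, B, ha, hc, hD, hB, H⟩ := Cycle.exists_frame (d := d) P M
  obtain ⟨C, hCpos, HN⟩ := Cycle.exists_nearPair_dirs (d := d) P M M
  have hμ := P.μ_pos
  have hη := P.η_pos
  have hL := P.L_pos
  set a0 := (1 + P.η) * P.L / P.μ with ha0
  have ha0' : 0 < a0 := by positivity
  set ρ := (1 + P.η) * P.L with hρ
  have hρ' : 0 < ρ := by positivity
  obtain ⟨C', hC'⟩ : ∃ C', C' = C + P.L * C + 1 / 2 * a0 ^ 2 + (ρ + M * (D * ρ) * a)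
    + 2 * (M * B) * P.L := ⟨_, rfl⟩
  have t1 : 0 < P.L * C := by positivity
  have t2 : 0 < 1 / 2 * a0 ^ 2 := by positivity
  have t3 : 0 < ρ + M * (D * ρ) * a := by positivity
  have t4 : 0 ≤ 2 * (M * B) * P.L := by positivity
  -- This radius gives `2 n B (C ε) ≤ E`, the hypothesis of `Frame.exists_coeff`; the `+ 1` also
  -- ensures `δ ≤ 1`.
  refine ⟨C', 1 / (2 * (M * B) * C + 1), by linarith, by positivity, ?_,
    fun ty A xs κ x r p q b s n hC hE hn hsmall => ⟨?_, fun w hw => ?_⟩⟩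
  · rw [div_le_one (by positivity)]
    have : 0 ≤ 2 * (M * B) * C := by positivity
    linarith
  · have F := H ty A xs κ x r p q b s n hC hE hn
    refine sweep_inner_eq_zero ty p q s _ n (fun i hi => ?_) F.orth
    rw [← abs_pos]
    exact lt_of_lt_of_le (by positivity) (F.lower i hi)
  have F := H ty A xs κ x r p q b s n hC hE hn
  obtain ⟨-, h1, y, hy, hy1, hy2⟩ := HN ty A xs κ x r p q b s n hC hE hn w hw n le_rfl hn
  obtain ⟨ζ, hζ, hsw⟩ := F.sweep_eq n le_rfl (x (s + n), r (s + n))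
  have hk := hC.kappa_nonneg
  have hlin0 := hC.norm_lin_le (Nat.zero_le n)
  rw [add_zero] at hlin0
  have hrn := hC.norm_res_le (le_refl n)
  set E := ‖x s - xs‖ with hEdef
  set ε := κ * E ^ 2 with hε
  have hε0 : 0 ≤ ε := by positivity
  have : ∀ i, ∃ z, i < n → z ∈ krylov A n w ∧ ‖p (s + (i + 1)) - z‖ ≤ C * ε ∧
      ‖q (s + (i + 1)) + A z‖ ≤ C * ε := by
    intro i
    by_cases hi : i < n
    · obtain ⟨z, h⟩ := h1 i hi
      exact ⟨z, fun _ => h⟩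
    · exact ⟨0, fun h => absurd h hi⟩
  choose z hz using this
  have hnM : (n : ℝ) ≤ M := by exact_mod_cast hn
  have hsm : 2 * (n * B) * (C * ε) ≤ E := by
    rw [le_div_iff₀ (by positivity)] at hsmall
    calc 2 * (n * B) * (C * ε) ≤ 2 * (M * B) * (C * ε) := by gcongr
      _ = (κ * E * (2 * (M * B) * C)) * E := by rw [hε]; ring
      _ ≤ 1 * E := by
        gcongr
        have : 0 ≤ κ * E := by positivity
        linarith
      _ = E := one_mul _
  obtain ⟨hfr, hco⟩ := F.exists_coeff hB hC.coercive (finrank_krylov_le A w n)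
    (fun i hi => (hz i hi).1) (fun i hi => (hz i hi).2.2) hsm
  simp only at hy1 hy2
  have hle : C * ε ≤ C' * ε := by gcongr; linarith
  have hr1 : ‖(sweep ty p q s (x (s + n), r (s + n)) n).2 + A (x s - xs + y)‖ ≤
      (C + 1 / 2 * a0 ^ 2) * ε := by
    have e : (sweep ty p q s (x (s + n), r (s + n)) n).2 + A (x s - xs + y) =
        ((sweep ty p q s (x (s + n), r (s + n)) n).2 - r s + A y) + (r s + A (x s - xs)) := by
      rw [map_add]; abel
    rw [e, add_mul]
    exact (norm_add_le _ _).trans (add_le_add hy2 hlin0)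
  have hx1 : ‖(sweep ty p q s (x (s + n), r (s + n)) n).1 - xs - (x s - xs) - y‖ ≤ C * ε := by
    rwa [sub_sub_sub_cancel_right]
  refine ⟨z, y, fun i hi => (hz i hi).1, fun i hi => (hz i hi).2.1.trans hle,
    fun i hi => (hz i hi).2.2.trans hle, hfr, fun v hv => ?_, hy, hx1.trans hle,
    hr1.trans ?_, hy2.trans hle, ?_, ?_⟩
  · obtain ⟨ζ, e, h⟩ := hco v hv
    refine ⟨ζ, e, h.trans ?_⟩
    gcongr
    calc 2 * (n * B) * P.L ≤ 2 * (M * B) * P.L := by gcongr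
      _ ≤ C' := by linarith
  · gcongr; linarith
  · have e : (sweep ty p q s (x (s + n), r (s + n)) n).2 +
        A ((sweep ty p q s (x (s + n), r (s + n)) n).1 - xs) =
        ((sweep ty p q s (x (s + n), r (s + n)) n).2 + A (x s - xs + y)) +
          A ((sweep ty p q s (x (s + n), r (s + n)) n).1 - xs - (x s - xs) - y) := by
      simp only [map_add, map_sub]; abel
    rw [e]
    calc _ ≤ (C + 1 / 2 * a0 ^ 2) * ε + P.L * (C * ε) :=
          (norm_add_le _ _).trans (add_le_add hr1 ((hC.coercive.upper _).trans (by gcongr)))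
      _ = (C + 1 / 2 * a0 ^ 2 + P.L * C) * ε := by ring
      _ ≤ C' * ε := by gcongr; linarith
  · rw [hsw]
    have hζ' : ∀ i < n, |ζ i| ≤ D * ρ := fun i hi => by
      refine le_of_mul_le_mul_right ((hζ i hi).trans ?_) hE
      calc D * ‖r (s + n)‖ ≤ D * (ρ * E) := by gcongr
        _ = _ := by ring
    refine (norm_sub_sum_smul_le (by positivity) hζ' F.q_le).trans ?_
    calc ‖r (s + n)‖ + n * (D * ρ) * (a * E) ≤ ρ * E + M * (D * ρ) * (a * E) := by gcongr
      _ = (ρ + M * (D * ρ) * a) * E := by ring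
      _ ≤ C' * E := by gcongr; linarith

/-! ### Error bounds for a single cycle -/

theorem isLeast_polyValues_eq_zero {A : Vec d →L[ℝ] Vec d} {n : ℕ} {u : Vec d} {M : ℝ}
    (h : IsLeast (polyValues A n u) M) (h0 : ∃ z ∈ krylov A n u, u + A z = 0) : M = 0 := by
  obtain ⟨z, hz, hz0⟩ := h0
  apply le_antisymm
  · exact h.2 ((mem_polyValues_iff A n u 0).2 ⟨z, hz, by rw [hz0, norm_zero]⟩)
  · obtain ⟨z, -, rfl⟩ := (mem_polyValues_iff A n u M).1 h.1
    exact norm_nonneg _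

theorem norm_sum_smul_le_of_sum_abs {f : ℕ → Vec d} {ζ : ℕ → ℝ} {n : ℕ} {ε : ℝ}
    (hf : ∀ i < n, ‖f i‖ ≤ ε) :
    ‖∑ i ∈ Finset.range n, ζ i • f i‖ ≤ (∑ i ∈ Finset.range n, |ζ i|) * ε := by
  rw [Finset.sum_mul]
  refine norm_sum_le_of_le _ fun i hi => ?_
  rw [norm_smul, Real.norm_eq_abs]
  exact mul_le_mul_of_nonneg_left (hf i (Finset.mem_range.1 hi)) (abs_nonneg _)

theorem krylov_eq_top {A : Vec d →L[ℝ] Vec d} {n : ℕ} {w : Vec d}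
    (h : Module.finrank ℝ (krylov A n w) = n) (hn : n = d) : krylov A n w = ⊤ := by
  apply Submodule.eq_top_of_finrank_eq
  rw [h, hn]; simp

/-- `R` differs from the optimal residual by a combination of the `q_i`, to which it is orthogonal,
up to `O(ε)`. The bound is on `A (x - xs)` because a cycle carries no linearization estimate at its
final point. -/
theorem Cycle.exists_bound_typeII (P : Params) (M : ℕ) : ∃ C δ : ℝ, 0 < C ∧ 0 < δ ∧
    ∀ (A : Vec d →L[ℝ] Vec d) (xs : Vec d) (κ : ℝ) (x r p q : ℕ → Vec d)
      (b : ℕ → ℝ) (s n : ℕ), Cycle P AMType.typeII A xs κ x r p q b s n → 0 < ‖x s - xs‖ →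
      n ≤ M → κ * ‖x s - xs‖ ≤ δ →
      ∃ m : ℝ, IsLeast (polyValues A n (r s)) m ∧ (n = d → m = 0) ∧
        ‖A (x (s + (n + 1)) - xs)‖ ≤ theta A (b (s + n)) * m + κ * (C * ‖x s - xs‖ ^ 2) := by
  obtain ⟨C, δ, hCp, hδ, hδ1, H⟩ := Cycle.exists_krylovFit (d := d) P M
  have hμ := P.μ_pos
  have hL := P.L_pos
  have hβ' := P.β'_pos
  -- `T` bounds the sum of the coordinates of `y + v`, which has norm at most `(L + 2 C) / μ * E`.
  obtain ⟨T, hT⟩ : ∃ T, T = C * ((P.L + 2 * C) / P.μ) := ⟨_, rfl⟩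
  have hTp : 0 < T := by rw [hT]; positivity
  refine ⟨(1 + P.β' * P.L) * (C + T * C) + C, δ, by positivity, hδ,
    fun A xs κ x r p q b s n hC hE hn hsmall => ?_⟩
  obtain ⟨horth, Hw⟩ := H _ A xs κ x r p q b s n hC hE hn hsmall
  have hk := hC.kappa_nonneg
  obtain ⟨z, y, Kf⟩ := Hw (r s) (by simp; positivity)
  obtain ⟨v, hv, hleast⟩ := exists_isLeast_polyValues A n (r s)
  refine ⟨_, hleast, fun hnd => isLeast_polyValues_eq_zero hleast ?_, ?_⟩
  · obtain ⟨u, hu⟩ := hC.coercive.surjective hμ (-(r s))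
    exact ⟨u, by rw [krylov_eq_top Kf.finrank_eq hnd]; trivial, by rw [hu, add_neg_cancel]⟩
  have hup := hC.update n le_rfl
  have hbm := hC.b_mem (s + n)
  have hb0 : 0 ≤ b (s + n) := P.β_pos.le.trans hbm.1
  have hth := theta_le hC.coercive hL.le hb0 hbm.2
  set R := (sweep AMType.typeII p q s (x (s + n), r (s + n)) n).2 with hR
  set X := (sweep AMType.typeII p q s (x (s + n), r (s + n)) n).1 with hX
  set E := ‖x s - xs‖ with hEdef
  set ε := κ * E ^ 2 with hε
  have hε0 : 0 ≤ ε := by positivity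
  have hεE : ε ≤ E := by
    calc ε = (κ * E) * E := by rw [hε]; ring
      _ ≤ 1 * E := by gcongr; exact hsmall.trans hδ1
      _ = E := one_mul _
  set m := ‖r s + A v‖ with hm
  have hmle : m ≤ P.L * E := by
    refine le_trans ?_ hC.res_upper
    exact hleast.2 ((mem_polyValues_iff A n (r s) _).2 ⟨0, zero_mem _, by simp⟩)
  have hRle : ‖R‖ ≤ m + (C + T * C) * ε := by
    -- Up to `O(ε)`, `R` is `r s - A y` and the optimal residual is `r s + A v`, so `A (y + v)` is
    -- the gap to be expressed through the `q_i`.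
    obtain ⟨ζ, hζ, hζ'⟩ := Kf.coeff (y + v) (add_mem Kf.mem' hv)
    have hyv : ‖y + v‖ ≤ (P.L + 2 * C) / P.μ * E := by
      rw [div_mul_eq_mul_div, le_div_iff₀ hμ, mul_comm]
      have e : A (y + v) = (r s + A v) + (R - r s + A y) - R := by rw [map_add]; abel
      calc P.μ * ‖y + v‖ ≤ ‖A (y + v)‖ := hC.coercive.norm_lower _
        _ ≤ m + C * ε + C * E := by
          rw [e]
          exact (norm_sub_le _ _).trans (add_le_add ((norm_add_le _ _).trans
            (add_le_add le_rfl Kf.r_near')) Kf.r_le)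
        _ ≤ P.L * E + C * E + C * E := by gcongr
        _ = _ := by ring
    have hS : ∑ i ∈ Finset.range n, |ζ i| ≤ T := by
      refine le_of_mul_le_mul_right (hζ'.trans ?_) hE
      rw [hT, mul_assoc]
      gcongr
    set Q := ∑ i ∈ Finset.range n, ζ i • q (s + (i + 1)) with hQ
    have hQR : inner ℝ R Q = 0 := by
      rw [hQ, inner_sum]
      refine Finset.sum_eq_zero fun i hi => ?_
      rw [inner_smul_right, real_inner_comm]
      exact mul_eq_zero_of_right _ (horth i (Finset.mem_range.1 hi))
    set W := ∑ i ∈ Finset.range n, ζ i • (q (s + (i + 1)) + A (z i)) with hW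
    have hWn : ‖W‖ ≤ T * (C * ε) :=
      (norm_sum_smul_le_of_sum_abs Kf.q_near).trans (by gcongr)
    have e1 : A (y + v) = W - Q := by
      rw [hζ, hW, hQ]
      simp only [smul_add, Finset.sum_add_distrib, map_sum, map_smul]; abel
    have e2 : R = ((r s + A v) + (R - r s + A y) - W) + Q := by
      have : Q = W - A (y + v) := by rw [e1]; abel
      rw [this, map_add]; abel
    have h1 : ‖R‖ ^ 2 ≤ inner ℝ R ((r s + A v) + (R - r s + A y) - W) := by
      have : inner ℝ R R = inner ℝ R ((r s + A v) + (R - r s + A y) - W) + inner ℝ R Q := by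
        rw [← inner_add_right, ← e2]
      rw [← real_inner_self_eq_norm_sq, this, hQR, add_zero]
    have h2 := mul_norm_le_of_mul_sq_le_inner (μ := 1) (by rwa [one_mul])
    rw [one_mul] at h2
    refine h2.trans ((norm_sub_le _ _).trans ?_)
    calc _ ≤ m + C * ε + T * (C * ε) := add_le_add ((norm_add_le _ _).trans
            (add_le_add le_rfl Kf.r_near')) hWn
      _ = _ := by ring
  -- The factor `I - b A` acts on `R`; the remainder is the linearization error of the projected
  -- pair.
  have e : -A (x (s + (n + 1)) - xs) = (R - b (s + n) • A R) - (R + A (X - xs)) := by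
    rw [hup]
    have : X + b (s + n) • R - xs = (X - xs) + b (s + n) • R := by abel
    rw [this, map_add, map_smul]; abel
  rw [← norm_neg, e]
  calc _ ≤ theta A (b (s + n)) * ‖R‖ + C * ε :=
        (norm_sub_le _ _).trans (add_le_add (norm_sub_smul_le_theta A _ R) Kf.lin)
    _ ≤ theta A (b (s + n)) * (m + (C + T * C) * ε) + C * ε := by
        have : 0 ≤ theta A (b (s + n)) := by unfold theta; positivity
        gcongr
    _ = theta A (b (s + n)) * m + (theta A (b (s + n)) * (C + T * C) + C) * ε := by ring
    _ ≤ theta A (b (s + n)) * m + ((1 + P.β' * P.L) * (C + T * C) + C) * ε := by gcongr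
    _ = _ := by rw [hε]; ring

/-- The residual of the fitted point is orthogonal to the Krylov subspace up to `O(ε)`. -/
theorem KrylovFit.norm_starProjection_le {A : Vec d →L[ℝ] Vec d} {K : Submodule ℝ (Vec d)}
    {u₀ r₀ : Vec d} {p q : ℕ → Vec d} {X R : Vec d} {n : ℕ} {C ε E : ℝ} {z : ℕ → Vec d} {y : Vec d}
    (Kf : KrylovFit A K u₀ r₀ p q X R n C ε E z y) (hC : 0 < C) (hE : 0 < E) (hε : 0 ≤ ε)
    (horth : ∀ i < n, inner ℝ (p i) R = 0) :
    ‖K.starProjection (A (u₀ + y))‖ ≤ (C ^ 3 + C) * ε := by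
  set u := u₀ + y with hu
  set w := K.starProjection (A u) with hw
  have hwK : w ∈ K := Submodule.starProjection_apply_mem K _
  obtain ⟨ζ, hζ, hζ'⟩ := Kf.coeff w hwK
  have h1 : ‖w‖ ^ 2 = inner ℝ w (A u) := by
    have h3 := Submodule.starProjection_inner_eq_zero (K := K) (A u) w hwK
    rw [inner_sub_left, sub_eq_zero] at h3
    rw [← real_inner_self_eq_norm_sq, real_inner_comm (A u) w, h3]
  set V := ∑ i ∈ Finset.range n, ζ i • (p i - z i) with hV
  -- The spare factor `E` is spent below on `‖R‖ ≤ C * E`.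
  have hVn : ‖V‖ * E ≤ C * ‖w‖ * (C * ε) := by
    calc ‖V‖ * E ≤ ((∑ i ∈ Finset.range n, |ζ i|) * (C * ε)) * E := by
          gcongr; exact norm_sum_smul_le_of_sum_abs Kf.p_near
      _ = ((∑ i ∈ Finset.range n, |ζ i|) * E) * (C * ε) := by ring
      _ ≤ _ := by gcongr
  have h2 : inner ℝ w R = -inner ℝ V R := by
    have e : w + V = ∑ i ∈ Finset.range n, ζ i • p i := by
      rw [hV, hζ, ← Finset.sum_add_distrib]
      exact Finset.sum_congr rfl fun i _ => by rw [← smul_add]; congr 1; abel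
    have : inner ℝ (w + V) R = 0 := by
      rw [e, sum_inner]
      refine Finset.sum_eq_zero fun i hi => ?_
      rw [inner_smul_left]
      exact mul_eq_zero_of_right _ (horth i (Finset.mem_range.1 hi))
    rw [inner_add_left] at this
    linarith
  have h3 : ‖w‖ ^ 2 ≤ ‖w‖ * ((C ^ 3 + C) * ε) := by
    have e : A u = (R + A u) - R := by abel
    calc ‖w‖ ^ 2 = inner ℝ w (R + A u) + inner ℝ V R := by
          rw [h1]; conv_lhs => rw [e, inner_sub_right, h2]
          ring
      _ ≤ ‖w‖ * ‖R + A u‖ + ‖V‖ * ‖R‖ :=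
          add_le_add (real_inner_le_norm _ _) (real_inner_le_norm _ _)
      _ ≤ ‖w‖ * (C * ε) + ‖V‖ * (C * E) := by
          gcongr
          · exact Kf.r_near
          · exact Kf.r_le
      _ = ‖w‖ * (C * ε) + C * (‖V‖ * E) := by ring
      _ ≤ ‖w‖ * (C * ε) + C * (C * ‖w‖ * (C * ε)) := by gcongr
      _ = _ := by ring
  rcases (norm_nonneg w).eq_or_lt with h0 | h0
  · rw [← h0]; positivity
  · rw [sq] at h3
    exact le_of_mul_le_mul_left h3 h0

/-- Two subspaces that fit the same cycle are close to each other. -/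
theorem KrylovFit.exists_near {A : Vec d →L[ℝ] Vec d} {K K' : Submodule ℝ (Vec d)}
    {u₀ r₀ : Vec d} {p q : ℕ → Vec d} {X R : Vec d} {n : ℕ} {C ε E : ℝ} {z z' : ℕ → Vec d}
    {y y' : Vec d} (Kf : KrylovFit A K u₀ r₀ p q X R n C ε E z y)
    (Kf' : KrylovFit A K' u₀ r₀ p q X R n C ε E z' y') (hC : 0 < C) (hE : 0 < E) (hε : 0 ≤ ε)
    {t : Vec d} (ht : t ∈ K') (htE : ‖t‖ ≤ 2 * E) : ∃ g ∈ K, ‖g - t‖ ≤ 4 * C ^ 2 * ε := by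
  obtain ⟨ζ, hζ, hζ'⟩ := Kf'.coeff t ht
  have hS : ∑ i ∈ Finset.range n, |ζ i| ≤ 2 * C := by
    refine le_of_mul_le_mul_right (hζ'.trans ?_) hE
    calc C * ‖t‖ ≤ C * (2 * E) := by gcongr
      _ = _ := by ring
  -- The coordinates of `t` in the basis `z'` are reused with `z`: both families approximate the
  -- same `p i`.
  refine ⟨∑ i ∈ Finset.range n, ζ i • z i, Submodule.sum_mem _ fun i hi =>
    Submodule.smul_mem _ _ (Kf.mem i (Finset.mem_range.1 hi)), ?_⟩
  rw [hζ, ← Finset.sum_sub_distrib]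
  simp only [← smul_sub]
  refine (norm_sum_smul_le_of_sum_abs (ε := C * ε + C * ε) fun i hi => ?_).trans ?_
  · have e : z i - z' i = (p i - z' i) - (p i - z i) := by abel
    rw [e]
    exact (norm_sub_le _ _).trans (add_le_add (Kf'.p_near i hi) (Kf.p_near i hi))
  · calc _ ≤ 2 * C * (C * ε + C * ε) := by gcongr
      _ = _ := by ring

theorem sqrt_gam_kap_le {A : Vec d →L[ℝ] Vec d} {μ L : ℝ} (hA : Coercive A μ L)
    (hμ : 0 < μ) (hL : 0 ≤ L) (K : Submodule ℝ (Vec d)) :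
    Real.sqrt (1 + gam A K ^ 2 * kap A K ^ 2) ≤ 1 + L / μ := by
  have hgam := gam_le hA hL K
  have hkap := kap_le hA hμ K
  have hgam0 : 0 ≤ gam A K := by unfold gam; positivity
  have hkap0 : 0 ≤ kap A K := by unfold kap; positivity
  have h1 : gam A K * kap A K ≤ L / μ := by
    rw [div_eq_mul_one_div]; gcongr
  have h2 : 0 ≤ gam A K * kap A K := by positivity
  refine (Real.sqrt_le_sqrt (y := (1 + gam A K * kap A K) ^ 2) ?_).trans ?_
  · nlinarith
  · rw [Real.sqrt_sq (by positivity)]; linarith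

/-- The Galerkin condition lives on the Krylov space of `r s`, whereas the minimum is over `u0 + A
v` with `A v` in the Krylov space of `A u0`. The two spaces are `O(ε)`-close at scale `E`, so the
minimizer can be moved from one to the other. -/
theorem Cycle.exists_bound_typeI (P : Params) (M : ℕ) : ∃ C δ : ℝ, 0 < C ∧ 0 < δ ∧
    ∀ (A : Vec d →L[ℝ] Vec d) (xs : Vec d) (κ : ℝ) (x r p q : ℕ → Vec d)
      (b : ℕ → ℝ) (s n : ℕ), Cycle P AMType.typeI A xs κ x r p q b s n → 0 < ‖x s - xs‖ →
      n ≤ M → κ * ‖x s - xs‖ ≤ δ →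
      ∃ m : ℝ, IsLeast (polyValues A n (x s - xs)) m ∧ (n = d → m = 0) ∧
        ‖x (s + (n + 1)) - xs‖ ≤ theta A (b (s + n)) *
          Real.sqrt (1 + gam A (krylov A n (r s)) ^ 2 * kap A (krylov A n (r s)) ^ 2) * m +
          κ * (C * ‖x s - xs‖ ^ 2) := by
  obtain ⟨C, δ, hCp, hδ, hδ1, H⟩ := Cycle.exists_krylovFit (d := d) P M
  have hμ := P.μ_pos
  have hL := P.L_pos
  have hβ' := P.β'_pos
  -- The first term pays for moving `A v` into `K`, the second for the defect in the Galerkin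
  -- condition.
  obtain ⟨T, hT⟩ : ∃ T, T = (1 + P.L / P.μ) * (4 * C ^ 2) + 1 / P.μ * (C ^ 3 + C) := ⟨_, rfl⟩
  have hTp : 0 < T := by rw [hT]; positivity
  refine ⟨(1 + P.β' * P.L) * T + C + P.β' * C, δ, by positivity, hδ,
    fun A xs κ x r p q b s n hC hE hn hsmall => ?_⟩
  obtain ⟨horth, Hw⟩ := H _ A xs κ x r p q b s n hC hE hn hsmall
  have hk := hC.kappa_nonneg
  obtain ⟨z, y, Kf⟩ := Hw (r s) (by simp; positivity)
  obtain ⟨z', y', Kf'⟩ := Hw (-A (x s - xs)) (by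
    rw [sub_neg_eq_add]
    refine (hC.lin 0 (Nat.zero_le _)).trans ?_
    rw [add_zero]
    have : 0 ≤ κ * ‖x s - xs‖ ^ 2 := by positivity
    linarith)
  rw [krylov_neg, krylov_map_eq] at Kf'
  obtain ⟨v, hv, hleast⟩ := exists_isLeast_polyValues A n (x s - xs)
  refine ⟨_, hleast, fun hnd => isLeast_polyValues_eq_zero hleast ?_, ?_⟩
  · have htop : (krylov A n (x s - xs)).map (A : Vec d →ₗ[ℝ] Vec d) = ⊤ := by
      apply Submodule.eq_top_of_finrank_eq
      rw [Kf'.finrank_eq, hnd]; simp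
    obtain ⟨u, hu, hu'⟩ : -(x s - xs) ∈ (krylov A n (x s - xs)).map (A : Vec d →ₗ[ℝ] Vec d) := by
      rw [htop]; trivial
    have hu'' : A u = -(x s - xs) := hu'
    exact ⟨u, hu, by rw [hu'', add_neg_cancel]⟩
  have hup := hC.update n le_rfl
  have hbm := hC.b_mem (s + n)
  have hb0 : 0 ≤ b (s + n) := P.β_pos.le.trans hbm.1
  have hth := theta_le hC.coercive hL.le hb0 hbm.2
  set K := krylov A n (r s) with hK
  set R := (sweep AMType.typeI p q s (x (s + n), r (s + n)) n).2 with hR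
  set X := (sweep AMType.typeI p q s (x (s + n), r (s + n)) n).1 with hX
  set u0 := x s - xs with hu0
  set E := ‖u0‖ with hEdef
  set ε := κ * E ^ 2 with hε
  have hε0 : 0 ≤ ε := by positivity
  set m := ‖u0 + A v‖ with hm
  have hmle : m ≤ E :=
    hleast.2 ((mem_polyValues_iff A n u0 _).2 ⟨0, zero_mem _, by simp [hEdef]⟩)
  set u := u0 + y with hu
  have hgal := Kf.norm_starProjection_le hCp hE hε0 horth
  have hAv : ‖A v‖ ≤ 2 * E := by
    have e : A v = (u0 + A v) - u0 := by abel
    rw [e]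
    refine (norm_sub_le _ _).trans ?_
    linarith
  obtain ⟨g, hgK, hag⟩ := Kf.exists_near Kf' hCp hE hε0 ⟨v, hv, rfl⟩ hAv
  change ‖g - A v‖ ≤ _ at hag
  have ha : ‖u0 + g‖ ≤ m + 4 * C ^ 2 * ε := by
    have e : u0 + g = (u0 + A v) + (g - A v) := by abel
    rw [e]
    exact (norm_add_le _ _).trans (add_le_add le_rfl hag)
  have hkap := kap_le hC.coercive hμ K
  have hkap0 : 0 ≤ kap A K := by unfold kap; positivity
  have hθ0 : 0 ≤ theta A (b (s + n)) := by unfold theta; positivity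
  have hug := norm_le_of_galerkin hC.coercive hμ K (u := u) (a := u0 + g)
    (by positivity) (by rw [hu, add_sub_add_left_eq_sub]; exact sub_mem Kf.mem' hgK) hgal
  set S := Real.sqrt (1 + gam A K ^ 2 * kap A K ^ 2) with hSdef
  have hS0 : 0 ≤ S := Real.sqrt_nonneg _
  have hSle : S ≤ 1 + P.L / P.μ := sqrt_gam_kap_le hC.coercive hμ hL.le K
  have hun : ‖u‖ ≤ S * m + T * ε := by
    calc ‖u‖ ≤ S * ‖u0 + g‖ + kap A K * ((C ^ 3 + C) * ε) := hug
      _ ≤ S * (m + 4 * C ^ 2 * ε) + 1 / P.μ * ((C ^ 3 + C) * ε) := by gcongr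
      _ = S * m + (S * (4 * C ^ 2) + 1 / P.μ * (C ^ 3 + C)) * ε := by ring
      _ ≤ S * m + ((1 + P.L / P.μ) * (4 * C ^ 2) + 1 / P.μ * (C ^ 3 + C)) * ε := by gcongr
      _ = _ := by rw [hT]
  have e : x (s + (n + 1)) - xs = (u - b (s + n) • A u) + (X - xs - u0 - y)
      + b (s + n) • (R + A u) := by
    rw [hup, hu, smul_add]; abel
  rw [e]
  calc _ ≤ theta A (b (s + n)) * ‖u‖ + C * ε + b (s + n) * (C * ε) := by
        refine norm_add₃_le.trans (add_le_add (add_le_add (norm_sub_smul_le_theta A _ u)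
          Kf.x_near) ?_)
        rw [norm_smul, Real.norm_of_nonneg hb0]
        gcongr
        exact Kf.r_near
    _ ≤ theta A (b (s + n)) * (S * m + T * ε) + C * ε + P.β' * (C * ε) := by
        have := hbm.2
        gcongr
    _ = theta A (b (s + n)) * S * m + (theta A (b (s + n)) * T + C + P.β' * C) * ε := by ring
    _ ≤ theta A (b (s + n)) * S * m + ((1 + P.β' * P.L) * T + C + P.β' * C) * ε := by gcongr
    _ = _ := by rw [hε]; ring

/-! ### The residual near the solution -/

theorem residual_eq_neg_hMap (g : Vec d → Vec d) (x : Vec d) : residual g x = -hMap g x := by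
  simp [residual, hMap]

section Local

variable {g : Vec d → Vec d} {xs : Vec d} {ρ κ μ L : ℝ}

theorem LocalBounds.jac_eq (h : LocalBounds g xs ρ κ μ L) :
    jac g xs = fderiv ℝ (hMap g) xs := by
  have hd := h.differentiable xs (Metric.mem_closedBall_self h.rho_pos.le)
  have h1 : HasFDerivAt g (ContinuousLinearMap.id ℝ (Vec d) - fderiv ℝ (hMap g) xs) xs :=
    ((hasFDerivAt_id (𝕜 := ℝ) xs).sub hd.hasFDerivAt).congr_of_eventuallyEq
      (Filter.Eventually.of_forall fun x => by simp [hMap])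
  rw [jac, h1.fderiv, sub_sub_cancel]

theorem LocalBounds.coercive (h : LocalBounds g xs ρ κ μ L) : Coercive (jac g xs) μ L := by
  have hm := Metric.mem_closedBall_self (x := xs) h.rho_pos.le
  rw [h.jac_eq]
  exact ⟨fun y => (h.form_bounds xs hm y).1, fun y => (h.norm_bounds xs hm y).2⟩

/-- Mean value theorem for `t ↦ (x - y)ᵀ h(y + t (x - y))`, whose derivative is at least `μ ‖x -
y‖²`. -/
theorem LocalBounds.monotone (h : LocalBounds g xs ρ κ μ L) {x y : Vec d}
    (hx : x ∈ Metric.closedBall xs ρ) (hy : y ∈ Metric.closedBall xs ρ) :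
    μ * ‖x - y‖ ^ 2 ≤ inner ℝ (x - y) (hMap g x - hMap g y) := by
  have hmem : ∀ t ∈ Set.Icc (0 : ℝ) 1, y + t • (x - y) ∈ Metric.closedBall xs ρ := fun t ht =>
    (convex_closedBall xs ρ).add_smul_sub_mem hy hx ht
  have hder : ∀ t ∈ Set.Icc (0 : ℝ) 1, HasDerivAt
      (fun t : ℝ => (inner ℝ (x - y) (hMap g (y + t • (x - y))) : ℝ))
      (inner ℝ (x - y) (fderiv ℝ (hMap g) (y + t • (x - y)) (x - y))) t := by
    intro t ht
    have h1 : HasDerivAt (fun t : ℝ => y + t • (x - y)) (x - y) t := by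
      simpa using ((hasDerivAt_id t).smul_const (x - y)).const_add y
    have h2 := (h.differentiable _ (hmem t ht)).hasFDerivAt.comp_hasDerivAt t h1
    have h3 := (hasDerivAt_const t (x - y)).inner ℝ h2
    simpa using h3
  obtain ⟨c, hc, hc'⟩ := exists_hasDerivAt_eq_slope _ _ (zero_lt_one' ℝ)
    (fun t ht => (hder t ht).continuousAt.continuousWithinAt)
    (fun t ht => hder t (Set.Ioo_subset_Icc_self ht))
  have h4 := (h.form_bounds _ (hmem c (Set.Ioo_subset_Icc_self hc)) (x - y)).1
  rw [hc'] at h4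
  simpa [inner_sub_right] using h4

theorem LocalBounds.residual_lower (h : LocalBounds g xs ρ κ μ L) (h0 : hMap g xs = 0) {x : Vec d}
    (hx : x ∈ Metric.closedBall xs ρ) : μ * ‖x - xs‖ ≤ ‖residual g x‖ := by
  have h1 := h.monotone hx (Metric.mem_closedBall_self h.rho_pos.le)
  rw [h0, sub_zero] at h1
  rw [residual_eq_neg_hMap, norm_neg]
  exact mul_norm_le_of_mul_sq_le_inner h1

theorem LocalBounds.residual_upper (h : LocalBounds g xs ρ κ μ L) (h0 : hMap g xs = 0) {x : Vec d}
    (hx : x ∈ Metric.closedBall xs ρ) : ‖residual g x‖ ≤ L * ‖x - xs‖ := by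
  have h1 := (convex_closedBall xs ρ).norm_image_sub_le_of_norm_fderiv_le (𝕜 := ℝ)
    (f := hMap g) (C := L) h.differentiable
    (fun z hz => ContinuousLinearMap.opNorm_le_bound _ h.L_pos.le
      fun y => (h.norm_bounds z hz y).2) (Metric.mem_closedBall_self h.rho_pos.le) hx
  rwa [h0, sub_zero, ← norm_neg, ← residual_eq_neg_hMap] at h1

theorem LocalBounds.residual_lin (h : LocalBounds g xs ρ κ μ L) {x : Vec d}
    (hx : x ∈ Metric.closedBall xs ρ) :
    ‖residual g x + jac g xs (x - xs)‖ ≤ 1 / 2 * κ * ‖x - xs‖ ^ 2 := by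
  rw [h.jac_eq, residual_eq_neg_hMap, ← norm_neg, neg_add, neg_neg, ← sub_eq_add_neg]
  exact h.quadratic x hx

end Local

/-! ### From runs to cycles -/

section Run

variable {ty : AMType} {g : Vec d → Vec d} {b : ℕ → ℝ} {m : ℕ} {τ η : ℝ} {x : ℕ → Vec d}
  {mk : ℕ → ℕ} {p q : ℕ → Vec d}

theorem IsRun.eq_testedDepth (h : IsRun ty g b m τ η x mk p q) {k : ℕ} (hk : 0 < mk k) :
    testedDepth g m η x mk k = mk k ∧
      τ * |inner ℝ (vVec ty p q (k - mk k + 1)) (q (k - mk k + 1))| ≤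
        |inner ℝ (vVec ty p q k) (q k)| := by
  have h1 := h.depth k
  split_ifs at h1 with hc
  · omega
  · rw [← h1] at hc
    refine ⟨h1.symm, ?_⟩
    by_contra hlt
    exact hc ⟨hk, not_le.1 hlt⟩

theorem IsRun.eq_enteringDepth (h : IsRun ty g b m τ η x mk p q) {k : ℕ} (hk : 0 < mk k) :
    enteringDepth mk k = mk k ∧ mk k ≤ m ∧
      ‖residual g (x k)‖ ≤ η * ‖residual g (x (k - mk k))‖ := by
  have h1 := (h.eq_testedDepth hk).1
  unfold testedDepth at h1
  split_ifs at h1 with hc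
  · omega
  · rw [h1] at hc
    push Not at hc
    exact ⟨h1, hc⟩

theorem IsRun.depth_le (h : IsRun ty g b m τ η x mk p q) (k : ℕ) : mk k ≤ m := by
  rcases Nat.eq_zero_or_pos (mk k) with h0 | h0
  · omega
  · exact (h.eq_enteringDepth h0).2.1

/-- A positive depth exceeds the previous one by exactly one, so depth `n` forces the depths `0, …,
n` on the steps leading up to it. -/
theorem IsRun.depth_of_cycle (h : IsRun ty g b m τ η x mk p q) (n : ℕ) : ∀ k, mk k = n →
    n ≤ k ∧ ∀ j ≤ n, mk (k - n + j) = j := by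
  induction n with
  | zero => intro k hk; exact ⟨Nat.zero_le _, fun j hj => by
      obtain rfl : j = 0 := by omega
      simpa using hk⟩
  | succ n ih =>
    intro k hk
    have h1 := (h.eq_enteringDepth (k := k) (by omega)).1
    rcases k with _ | k
    · simp [enteringDepth] at h1; omega
    · change mk k + 1 = _ at h1
      obtain ⟨h2, h3⟩ := ih k (by omega)
      refine ⟨by omega, fun j hj => ?_⟩
      rw [Nat.add_sub_add_right]
      rcases Nat.lt_or_ge n j with hj' | hj'
      · obtain rfl : j = n + 1 := by omega
        rw [show k - n + (n + 1) = k + 1 by omega, hk]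
      · exact h3 j hj'

theorem IsRun.cycle (P : Params) (hrun : IsRun ty g b m P.τ P.η x mk p q) {xs : Vec d} {ρ κ : ℝ}
    (h : LocalBounds g xs ρ κ P.μ P.L) (h0 : hMap g xs = 0) (hb : ∀ j, b j ∈ Set.Icc P.β P.β')
    {k : ℕ} (hball : ∀ j ≤ k, x j ∈ Metric.closedBall xs ρ) :
    Cycle P ty (jac g xs) xs κ x (fun j => residual g (x j)) p q b (k - mk k) (mk k) := by
  obtain ⟨hnk, hmk⟩ := hrun.depth_of_cycle (mk k) k rfl
  set n := mk k with hn
  set s := k - n with hs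
  have hpos : ∀ j < n, 0 < mk (s + (j + 1)) := fun j hj => by rw [hmk _ hj]; omega
  have htd : ∀ j < n, testedDepth g m P.η x mk (s + (j + 1)) = j + 1 := fun j hj => by
    rw [(hrun.eq_testedDepth (hpos j hj)).1, hmk _ hj]
  have hb' : ∀ j ≤ n, x (s + j) ∈ Metric.closedBall xs ρ := fun j hj => hball _ (by omega)
  have hbs : x s ∈ Metric.closedBall xs ρ := hball _ (by omega)
  refine ⟨h.coercive, h.kappa_pos.le, hb, fun j hj => ?_, fun j hj => ?_, fun j hj => ?_,
    fun j hj => ?_, fun j hj => h.residual_lower h0 (hb' j hj), h.residual_upper h0 hbs,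
    fun j hj => h.residual_lin (hb' j hj), fun hn0 => ?_⟩
  · have h1 := hrun.newPair (s + (j + 1)) (by rw [htd j hj]; omega)
    rwa [htd j hj, Nat.add_sub_cancel, Nat.add_sub_cancel,
      show s + (j + 1) - 1 = s + j by omega] at h1
  · have h1 := (hrun.eq_testedDepth (hpos j hj)).2
    rwa [hmk _ hj, Nat.add_sub_cancel] at h1
  · have h1 := hrun.update (s + j)
    rwa [hmk j hj, Nat.add_sub_cancel] at h1
  -- The factor `1 + η` covers `j = 0`, where no test compares the residual with itself and `η` may
  -- be below one.
  · have hη := P.η_pos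
    rcases j with _ | j
    · rw [add_zero]
      have : 0 ≤ P.η * ‖residual g (x s)‖ := by positivity
      linarith
    · have h1 := (hrun.eq_enteringDepth (hpos j hj)).2.2
      rw [hmk _ hj, Nat.add_sub_cancel] at h1
      have : 0 ≤ ‖residual g (x s)‖ := norm_nonneg _
      linarith
  · have h1 := h.monotone (hb' 1 hn0) hbs
    simp only [residual_eq_neg_hMap]
    convert h1 using 2
    abel

end Run

/-- As long as the residuals stay comparable with the first one, the iterates stay in the ball and
comparable with the starting point. -/
theorem IsRun.exists_invariant (P : Params) (m : ℕ) {η₀ : ℝ} (hη₀ : 0 < η₀) : ∃ e : ℝ, 0 < e ∧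
    ∀ (ty : AMType) (g : Vec d → Vec d) (xs : Vec d) (ρ κ : ℝ), LocalBounds g xs ρ κ P.μ P.L →
    hMap g xs = 0 → ∀ (b : ℕ → ℝ), (∀ j, b j ∈ Set.Icc P.β P.β') →
    ∀ (x : ℕ → Vec d) (mk : ℕ → ℕ) (p q : ℕ → Vec d), IsRun ty g b m P.τ P.η x mk p q →
    ‖x 0 - xs‖ ≤ ρ → e * ‖x 0 - xs‖ ≤ ρ → ∀ k : ℕ,
    (∀ j ≤ k, ‖residual g (x j)‖ ≤ η₀ * ‖residual g (x 0)‖) →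
    (∀ j ≤ k + 1, x j ∈ Metric.closedBall xs ρ) ∧ ∀ j ≤ k, ‖x j - xs‖ ≤ e * ‖x 0 - xs‖ := by
  obtain ⟨G, hG, HG⟩ := Cycle.exists_growth (d := d) P m
  have hμ := P.μ_pos
  have hL := P.L_pos
  set a := η₀ * P.L / P.μ with ha
  have ha0 : 0 < a := by positivity
  -- `a` bounds the iterates whose residuals are controlled, and `G * a` the next iterate, about
  -- whose residual nothing is assumed.
  refine ⟨(1 + G) * a, by positivity,
    fun ty g xs ρ κ h h0 b hb x mk p q hrun hρ hδ k hres => ?_⟩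
  have hx0 : x 0 ∈ Metric.closedBall xs ρ := by rwa [mem_closedBall_iff_norm]
  have hcomp : ∀ j ≤ k, x j ∈ Metric.closedBall xs ρ → ‖x j - xs‖ ≤ a * ‖x 0 - xs‖ := by
    intro j hj hx
    have h1 := h.residual_lower h0 hx
    have h2 := h.residual_upper h0 hx0
    rw [ha, div_mul_eq_mul_div, le_div_iff₀ hμ]
    calc ‖x j - xs‖ * P.μ = P.μ * ‖x j - xs‖ := mul_comm _ _
      _ ≤ η₀ * ‖residual g (x 0)‖ := h1.trans (hres j hj)
      _ ≤ η₀ * (P.L * ‖x 0 - xs‖) := by gcongr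
      _ = _ := by ring
  have hball : ∀ j ≤ k + 1, x j ∈ Metric.closedBall xs ρ := by
    intro j
    induction j using Nat.strong_induction_on with
    | _ j ih =>
      intro hj
      rcases j with _ | j
      · exact hx0
      have hC := hrun.cycle P h h0 hb (k := j) (fun i hi => ih i (by omega) (by omega))
      have hnj := (hrun.depth_of_cycle _ j rfl).1
      have h1 := HG _ _ _ _ _ _ _ _ _ _ _ hC (hrun.depth_le j)
      rw [← add_assoc, Nat.sub_add_cancel hnj] at h1
      rw [mem_closedBall_iff_norm]
      refine h1.trans (le_trans ?_ hδ)
      calc G * ‖x (j - mk j) - xs‖ ≤ G * (a * ‖x 0 - xs‖) := by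
            gcongr
            exact hcomp _ (by omega) (ih _ (by omega) (by omega))
        _ ≤ (1 + G) * a * ‖x 0 - xs‖ := by
            have : 0 ≤ a * ‖x 0 - xs‖ := by positivity
            linarith
  refine ⟨hball, fun j hj => (hcomp j hj (hball j (by omega))).trans ?_⟩
  gcongr
  have : 0 ≤ G * a := by positivity
  linarith

/-- Allowing every `C ≥ C₀` lets both types share one constant. The case `x s = xs`, excluded so
far, follows from the growth bound. -/
theorem Cycle.exists_boundI (P : Params) (m : ℕ) : ∃ C₀ δ : ℝ, 0 < C₀ ∧ 0 < δ ∧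
    ∀ C, C₀ ≤ C → ∀ (g : Vec d → Vec d) (xs : Vec d) (κ : ℝ) (x p q : ℕ → Vec d)
      (b : ℕ → ℝ) (s n : ℕ),
      Cycle P AMType.typeI (jac g xs) xs κ x (fun j => residual g (x j)) p q b s n →
      n ≤ m → κ * ‖x s - xs‖ ≤ δ →
      BoundI g xs κ P.μ P.L C (b (s + n)) n (x s) (x (s + (n + 1))) ∧
      (n = d → ‖x (s + (n + 1)) - xs‖ ≤ κ * (C * ‖x s - xs‖ ^ 2)) := by
  obtain ⟨C₀, δ, hC₀, hδ, H⟩ := Cycle.exists_bound_typeI (d := d) P m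
  obtain ⟨G, hG, HG⟩ := Cycle.exists_growth (d := d) P m
  have hμ := P.μ_pos
  have hL := P.L_pos
  refine ⟨C₀, δ, hC₀, hδ, fun C hCC g xs κ x p q b s n hC hn hsm => ?_⟩
  have hk := hC.kappa_nonneg
  have hCp : 0 < C := hC₀.trans_le hCC
  have hpre := And.intro (compression_isInvertible hC.coercive hμ (krylov (jac g xs) n
    (residual g (x s)))) (And.intro (gam_le hC.coercive hL.le (krylov (jac g xs) n
    (residual g (x s)))) (kap_le hC.coercive hμ (krylov (jac g xs) n (residual g (x s)))))
  rcases (norm_nonneg (x s - xs)).eq_or_lt with h0 | hE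
  · have h1 := HG _ _ _ _ _ _ _ _ _ _ _ hC hn
    rw [← h0, mul_zero] at h1
    obtain ⟨z, -, hz⟩ := exists_isLeast_polyValues (jac g xs) n (x s - xs)
    refine ⟨⟨hpre.1, hpre.2.1, hpre.2.2, _, hz, h1.trans ?_⟩, fun _ => h1.trans (by positivity)⟩
    have : 0 ≤ theta (jac g xs) (b (s + n)) := by unfold theta; positivity
    positivity
  · obtain ⟨M, hM, hMd, hb⟩ := H _ _ _ _ _ _ _ _ _ _ hC hE hn hsm
    have hle : κ * (C₀ * ‖x s - xs‖ ^ 2) ≤ κ * (C * ‖x s - xs‖ ^ 2) := by gcongr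
    refine ⟨⟨hpre.1, hpre.2.1, hpre.2.2, M, hM, hb.trans (by gcongr)⟩, fun hnd => ?_⟩
    rw [hMd hnd, mul_zero, zero_add] at hb
    exact hb.trans hle

theorem Cycle.exists_boundII (P : Params) (m : ℕ) : ∃ C₀ δ : ℝ, 0 < C₀ ∧ 0 < δ ∧
    ∀ C, C₀ ≤ C → ∀ (g : Vec d → Vec d) (xs : Vec d) (ρ κ : ℝ) (x p q : ℕ → Vec d)
      (b : ℕ → ℝ) (s n : ℕ), LocalBounds g xs ρ κ P.μ P.L → hMap g xs = 0 →
      Cycle P AMType.typeII (jac g xs) xs κ x (fun j => residual g (x j)) p q b s n →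
      n ≤ m → κ * ‖x s - xs‖ ≤ δ → x (s + (n + 1)) ∈ Metric.closedBall xs ρ →
      BoundII g xs κ C (b (s + n)) n (x s) (x (s + (n + 1))) ∧
      (n = d → ‖x (s + (n + 1)) - xs‖ ≤ κ * (C * ‖x s - xs‖ ^ 2)) := by
  obtain ⟨C₁, δ, hC₁, hδ, H⟩ := Cycle.exists_bound_typeII (d := d) P m
  obtain ⟨G, hG, HG⟩ := Cycle.exists_growth (d := d) P m
  have hμ := P.μ_pos
  have hL := P.L_pos
  -- The extra term is the linearization error at the final point, at distance at most `G * E` from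
  -- the solution. The further `C₂ / μ` below converts a residual bound into an error bound.
  obtain ⟨C₂, hC₂⟩ : ∃ C₂, C₂ = C₁ + 1 / 2 * G ^ 2 := ⟨_, rfl⟩
  have hC₂p : 0 < C₂ := by rw [hC₂]; positivity
  refine ⟨C₂ + C₂ / P.μ, δ, by positivity, hδ,
    fun C hCC g xs ρ κ x p q b s n h h0 hC hn hsm hball => ?_⟩
  have hk := hC.kappa_nonneg
  have hdiv : 0 < C₂ / P.μ := by positivity
  have hCp : 0 < C := by linarith
  have hg := HG _ _ _ _ _ _ _ _ _ _ _ hC hn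
  have hlow := h.residual_lower h0 hball
  rcases (norm_nonneg (x s - xs)).eq_or_lt with hE0 | hE
  · rw [← hE0, mul_zero] at hg
    have hr := h.residual_upper h0 hball
    have hr0 : ‖residual g (x (s + (n + 1)))‖ ≤ 0 :=
      hr.trans (mul_nonpos_of_nonneg_of_nonpos hL.le hg)
    obtain ⟨z, -, hz⟩ := exists_isLeast_polyValues (jac g xs) n (residual g (x s))
    refine ⟨⟨_, hz, hr0.trans ?_⟩, fun _ => hg.trans (by positivity)⟩
    have : 0 ≤ theta (jac g xs) (b (s + n)) := by unfold theta; positivity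
    positivity
  · obtain ⟨M, hM, hMd, hb⟩ := H _ _ _ _ _ _ _ _ _ _ hC hE hn hsm
    have hlin := h.residual_lin hball
    have hr : ‖residual g (x (s + (n + 1)))‖ ≤
        theta (jac g xs) (b (s + n)) * M + κ * (C₂ * ‖x s - xs‖ ^ 2) := by
      have e : residual g (x (s + (n + 1))) = (residual g (x (s + (n + 1))) +
        jac g xs (x (s + (n + 1)) - xs)) - jac g xs (x (s + (n + 1)) - xs) := by abel
      rw [e]
      calc _ ≤ 1 / 2 * κ * (G * ‖x s - xs‖) ^ 2 + (theta (jac g xs) (b (s + n)) * M +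
            κ * (C₁ * ‖x s - xs‖ ^ 2)) := (norm_sub_le _ _).trans (add_le_add
              (hlin.trans (by gcongr)) hb)
        _ = _ := by rw [hC₂]; ring
    refine ⟨⟨M, hM, hr.trans ?_⟩, fun hnd => ?_⟩
    · gcongr; linarith
    · rw [hMd hnd, mul_zero, zero_add] at hr
      have h1 := hlow.trans hr
      calc ‖x (s + (n + 1)) - xs‖ ≤ κ * (C₂ * ‖x s - xs‖ ^ 2) / P.μ := by
            rw [le_div_iff₀ hμ]; linarith
        _ = κ * (C₂ / P.μ * ‖x s - xs‖ ^ 2) := by ring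
        _ ≤ _ := by gcongr; linarith

/-! ### Existence of admissible constants -/

theorem exists_pos_mul_le (a c : ℝ) (hc : 0 < c) : ∃ δ : ℝ, 0 < δ ∧ a * δ ≤ c := by
  refine ⟨c / (|a| + 1), by positivity, ?_⟩
  rw [mul_div_assoc', div_le_iff₀ (by positivity)]
  nlinarith [le_abs_self a]

/-- `A` and its symmetric part have the same quadratic form, and the infimum of the Rayleigh
quotient is an eigenvalue. Nontriviality provides that eigenvalue. -/
theorem exists_symPart_lower [Nontrivial (Vec d)] (A : Vec d →L[ℝ] Vec d)
    (hpos : ∀ ν : ℝ, Module.End.HasEigenvalue (symPart A : Vec d →ₗ[ℝ] Vec d) ν → 0 < ν) :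
    ∃ μ : ℝ, 0 < μ ∧ ∀ y, μ * ‖y‖ ^ 2 ≤ inner ℝ y (A y) := by
  have hinner : ∀ y z, inner ℝ (symPart A y) z =
      (1 / 2 : ℝ) * (inner ℝ (A y) z + inner ℝ y (A z)) := by
    intro y z
    change inner ℝ ((1 / 2 : ℝ) • (A y + ContinuousLinearMap.adjoint A y)) z = _
    rw [real_inner_smul_left, inner_add_left, ContinuousLinearMap.adjoint_inner_left]
  have hsymm : (symPart A : Vec d →ₗ[ℝ] Vec d).IsSymmetric := by
    intro y z
    change inner ℝ (symPart A y) z = inner ℝ y (symPart A z)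
    rw [hinner, real_inner_comm (symPart A z) y, hinner, real_inner_comm z (A y),
      real_inner_comm (A z) y, real_inner_comm (A y) z]
    ring
  have hself : ∀ y, inner ℝ (symPart A y) y = inner ℝ y (A y) := by
    intro y
    rw [hinner, real_inner_comm]; ring
  have hev := hpos _ hsymm.hasEigenvalue_iInf_of_finiteDimensional
  refine ⟨_, hev, fun y => ?_⟩
  by_cases hy : y = 0
  · simp [hy]
  have hy' : 0 < ‖y‖ := norm_pos_iff.2 hy
  rw [← le_div_iff₀ (by positivity)]
  refine (ciInf_le ⟨-‖A‖, ?_⟩ ⟨y, hy⟩).trans_eq ?_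
  · rintro _ ⟨⟨z, hz⟩, rfl⟩
    have hz' : 0 < ‖z‖ := norm_pos_iff.2 hz
    change -‖A‖ ≤ (inner ℝ (symPart A z) z : ℝ) / ‖z‖ ^ 2
    rw [hself, le_div_iff₀ (by positivity)]
    have h1 := abs_le.1 ((abs_real_inner_le_norm z (A z)).trans
      (mul_le_mul_of_nonneg_left (A.le_opNorm z) (norm_nonneg z)))
    linarith [h1.1, sq ‖z‖]
  · change (inner ℝ (symPart A y) y : ℝ) / ‖y‖ ^ 2 = _
    rw [hself]

theorem Assumption.exists_localBounds [Nontrivial (Vec d)] {g : Vec d → Vec d} {xs : Vec d}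
    (h : Assumption g xs) : ∃ ρ κ μ L : ℝ, LocalBounds g xs ρ κ μ L := by
  obtain ⟨ν, hν, hlow⟩ := exists_symPart_lower _ h.posDef
  obtain ⟨U, hU, hdiff, K, hK⟩ := h.smooth
  obtain ⟨ε, hε, hεU⟩ := Metric.mem_nhds_iff.1 hU
  set A := fderiv ℝ (hMap g) xs with hA
  -- On this radius the derivative moves by at most `ν / 2`, so half of the coercivity constant
  -- survives.
  obtain ⟨δ, hδ, hKδ⟩ := exists_pos_mul_le K (ν / 2) (by positivity)
  set ρ := min (ε / 2) δ with hρ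
  have hρ0 : 0 < ρ := by positivity
  have hball : ∀ x ∈ Metric.closedBall xs ρ, x ∈ U := fun x hx => hεU (by
    have h1 := Metric.mem_closedBall.1 hx
    have h2 : ρ ≤ ε / 2 := min_le_left _ _
    rw [Metric.mem_ball]; linarith)
  have hxsU : xs ∈ U := hball xs (Metric.mem_closedBall_self hρ0.le)
  have hD : ∀ x ∈ Metric.closedBall xs ρ, ‖fderiv ℝ (hMap g) x - A‖ ≤ K * ‖x - xs‖ :=
    fun x hx => hK.norm_sub_le (hball x hx) hxsU
  have hD2 : ∀ x ∈ Metric.closedBall xs ρ, ‖fderiv ℝ (hMap g) x - A‖ ≤ ν / 2 := fun x hx => by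
    refine (hD x hx).trans (le_trans ?_ hKδ)
    gcongr
    exact (mem_closedBall_iff_norm.1 hx).trans (min_le_right _ _)
  have hup : ∀ x ∈ Metric.closedBall xs ρ, ∀ y, ‖fderiv ℝ (hMap g) x y‖ ≤ (‖A‖ + ν) * ‖y‖ := by
    intro x hx y
    have e : fderiv ℝ (hMap g) x y = A y + (fderiv ℝ (hMap g) x - A) y := by simp
    rw [e]
    refine (norm_add_le _ _).trans ?_
    have h1 := A.le_opNorm y
    have h2 := (fderiv ℝ (hMap g) x - A).le_of_opNorm_le (hD2 x hx) y
    have h3 : 0 ≤ ν * ‖y‖ := by positivity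
    linarith
  have hlo : ∀ x ∈ Metric.closedBall xs ρ, ∀ y,
      ν / 2 * ‖y‖ ^ 2 ≤ inner ℝ y (fderiv ℝ (hMap g) x y) := by
    intro x hx y
    have e : fderiv ℝ (hMap g) x y = A y + (fderiv ℝ (hMap g) x - A) y := by simp
    rw [e, inner_add_right]
    have h1 := hlow y
    have h2 := (fderiv ℝ (hMap g) x - A).le_of_opNorm_le (hD2 x hx) y
    have h3 := (abs_le.1 ((abs_real_inner_le_norm y ((fderiv ℝ (hMap g) x - A) y)).trans
      (mul_le_mul_of_nonneg_left h2 (norm_nonneg y)))).1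
    have h4 : ‖y‖ * (ν / 2 * ‖y‖) = ν / 2 * ‖y‖ ^ 2 := by ring
    linarith
  refine ⟨ρ, 2 * K + 1, ν / 2, ‖A‖ + ν, hρ0, by positivity, by positivity, by positivity,
    fun x hx => hdiff x (hball x hx), fun x hx y =>
      ⟨mul_norm_le_of_mul_sq_le_inner (hlo x hx y), hup x hx y⟩, fun x hx y => ⟨hlo x hx y, ?_⟩,
    fun x hx => ?_⟩
  · calc inner ℝ y (fderiv ℝ (hMap g) x y) ≤ ‖y‖ * ‖fderiv ℝ (hMap g) x y‖ :=
          real_inner_le_norm _ _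
      _ ≤ ‖y‖ * ((‖A‖ + ν) * ‖y‖) := by gcongr; exact hup x hx y
      _ = _ := by ring
  -- The mean value inequality is used on the ball of radius `‖x - xs‖` rather than `ρ`: this
  -- produces the second factor `‖x - xs‖`.
  · have hsub : Metric.closedBall xs ‖x - xs‖ ⊆ Metric.closedBall xs ρ :=
      Metric.closedBall_subset_closedBall (mem_closedBall_iff_norm.1 hx)
    have h1 := (convex_closedBall xs ‖x - xs‖).norm_image_sub_le_of_norm_fderiv_le' (𝕜 := ℝ)
      (f := hMap g) (φ := A) (C := K * ‖x - xs‖)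
      (fun z hz => hdiff z (hball z (hsub hz)))
      (fun z hz => (hD z (hsub hz)).trans (by
        gcongr; exact mem_closedBall_iff_norm.1 hz))
      (Metric.mem_closedBall_self (norm_nonneg _)) (mem_closedBall_iff_norm.2 le_rfl)
    rw [h.zero, sub_zero] at h1
    refine h1.trans ?_
    have : 0 ≤ ‖x - xs‖ ^ 2 := by positivity
    linarith [sq ‖x - xs‖]

end RestartedAM

end

/-! ### Choice of the starting radius and conclusion -/

theorem theorem4p1 {d : ℕ} (m : ℕ) (hm : 0 < m) (hmd : m ≤ d)
    (τ : ℝ) (hτ0 : 0 < τ) (hτ1 : τ < 1) (η : ℝ) (hη : 0 < η) (η₀ : ℝ) (hη₀ : 0 < η₀)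
    (β β' : ℝ) (hβ : 0 < β) (hβ' : 0 < β') :
    -- the constants exist
    (∀ (g : RestartedAM.Vec d → RestartedAM.Vec d) (xs : RestartedAM.Vec d),
      RestartedAM.Assumption g xs → ∃ ρ κ μ L : ℝ, RestartedAM.LocalBounds g xs ρ κ μ L) ∧
    -- the results, for all admissible constants
    ∀ μ L : ℝ, 0 < μ → 0 < L → ∃ C : ℝ, 0 < C ∧
      ∀ (g : RestartedAM.Vec d → RestartedAM.Vec d) (xs : RestartedAM.Vec d),
        RestartedAM.Assumption g xs →
      ∀ ρ κ : ℝ, RestartedAM.LocalBounds g xs ρ κ μ L →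
        -- Type-I
        (∃ δ : ℝ, 0 < δ ∧ ∀ (b : ℕ → ℝ), (∀ j, b j ∈ Set.Icc β β') →
          ∀ (x : ℕ → RestartedAM.Vec d) (mk : ℕ → ℕ) (p q : ℕ → RestartedAM.Vec d),
            RestartedAM.IsRun RestartedAM.AMType.typeI g b m τ η x mk p q →
            ‖x 0 - xs‖ ≤ δ →
          ∀ k : ℕ,
            (∀ j ≤ k, ‖RestartedAM.residual g (x j)‖ ≤ η₀ * ‖RestartedAM.residual g (x 0)‖) →
            RestartedAM.BoundI g xs κ μ L C (b k) (mk k) (x (k - mk k)) (x (k + 1)) ∧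
            (mk k = d → ‖x (k + 1) - xs‖ ≤ κ * (C * ‖x (k - mk k) - xs‖ ^ 2))) ∧
        -- Type-II, with bounded residuals
        (∃ δ : ℝ, 0 < δ ∧ ∀ (b : ℕ → ℝ), (∀ j, b j ∈ Set.Icc β β') →
          ∀ (x : ℕ → RestartedAM.Vec d) (mk : ℕ → ℕ) (p q : ℕ → RestartedAM.Vec d),
            RestartedAM.IsRun RestartedAM.AMType.typeII g b m τ η x mk p q →
            ‖x 0 - xs‖ ≤ δ →
          ∀ k : ℕ,
            (∀ j ≤ k + 1,
              ‖RestartedAM.residual g (x j)‖ ≤ η₀ * ‖RestartedAM.residual g (x 0)‖) →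
            RestartedAM.BoundII g xs κ C (b k) (mk k) (x (k - mk k)) (x (k + 1)) ∧
            (mk k = d → ‖x (k + 1) - xs‖ ≤ κ * (C * ‖x (k - mk k) - xs‖ ^ 2))) ∧
        -- Type-II, with `θ_j ≤ θ < 1`
        (∀ θ ∈ Set.Ico (Real.sqrt (1 - μ ^ 2 / L ^ 2)) 1,
          ∃ δ : ℝ, 0 < δ ∧ ∀ (b : ℕ → ℝ), (∀ j, b j ∈ Set.Icc β β') →
          (∀ j, RestartedAM.theta (RestartedAM.jac g xs) (b j) ≤ θ) →
          ∀ (x : ℕ → RestartedAM.Vec d) (mk : ℕ → ℕ) (p q : ℕ → RestartedAM.Vec d),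
            RestartedAM.IsRun RestartedAM.AMType.typeII g b m τ η x mk p q →
            ‖x 0 - xs‖ ≤ δ →
          ∀ k : ℕ,
            RestartedAM.BoundII g xs κ C (b k) (mk k) (x (k - mk k)) (x (k + 1)) ∧
            (mk k = d → ‖x (k + 1) - xs‖ ≤ κ * (C * ‖x (k - mk k) - xs‖ ^ 2))) := by
  have hd : 0 < d := hm.trans_le hmd
  have : Nonempty (Fin d) := ⟨⟨0, hd⟩⟩
  refine ⟨fun g xs h => h.exists_localBounds, fun μ L hμ hL => ?_⟩
  let P : RestartedAM.Params := ⟨τ, η, β, β', μ, L, hτ0, hη, hβ, hβ', hμ, hL⟩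
  obtain ⟨C₁, δ₁, hC₁, hδ₁, H₁⟩ := RestartedAM.Cycle.exists_boundI (d := d) P m
  obtain ⟨C₂, δ₂, hC₂, hδ₂, H₂⟩ := RestartedAM.Cycle.exists_boundII (d := d) P m
  obtain ⟨e, he, hinv⟩ := RestartedAM.IsRun.exists_invariant (d := d) P m hη₀
  -- The comparison factor is `1` here because the contractive Type-II case shows that no residual
  -- exceeds the first.
  obtain ⟨e', he', hinv'⟩ := RestartedAM.IsRun.exists_invariant (d := d) P m one_pos
  refine ⟨C₁ + C₂, by positivity, fun g xs hA ρ κ hloc => ⟨?_, ?_, fun θ hθ => ?_⟩⟩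
  · have hρ := hloc.rho_pos
    have hκ := hloc.kappa_pos
    obtain ⟨s₁, hs₁, hs₁'⟩ := RestartedAM.exists_pos_mul_le e ρ hρ
    obtain ⟨s₂, hs₂, hs₂'⟩ := RestartedAM.exists_pos_mul_le (κ * e) δ₁ hδ₁
    refine ⟨min ρ (min s₁ s₂), by positivity, fun b hb x mk p q hrun hx0 k hres => ?_⟩
    simp only [le_min_iff] at hx0
    obtain ⟨hball, hcmp⟩ := hinv _ g xs ρ κ hloc hA.zero b hb x mk p q hrun hx0.1
      ((mul_le_mul_of_nonneg_left hx0.2.1 he.le).trans hs₁') k hres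
    have hC := hrun.cycle P hloc hA.zero hb (k := k) (fun j hj => hball j (by omega))
    have hnk := (hrun.depth_of_cycle _ k rfl).1
    have h1 := H₁ (C₁ + C₂) (by linarith) g xs κ x p q b _ _ hC (hrun.depth_le k) (by
      calc κ * ‖x (k - mk k) - xs‖ ≤ κ * (e * ‖x 0 - xs‖) := by
            gcongr; exact hcmp _ (Nat.sub_le _ _)
        _ ≤ κ * (e * s₂) := by gcongr; exact hx0.2.2
        _ = κ * e * s₂ := by ring
        _ ≤ δ₁ := hs₂')
    rwa [← add_assoc, Nat.sub_add_cancel hnk] at h1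
  · have hρ := hloc.rho_pos
    have hκ := hloc.kappa_pos
    obtain ⟨s₁, hs₁, hs₁'⟩ := RestartedAM.exists_pos_mul_le e ρ hρ
    obtain ⟨s₂, hs₂, hs₂'⟩ := RestartedAM.exists_pos_mul_le (κ * e) δ₂ hδ₂
    refine ⟨min ρ (min s₁ s₂), by positivity, fun b hb x mk p q hrun hx0 k hres => ?_⟩
    simp only [le_min_iff] at hx0
    obtain ⟨hball, hcmp⟩ := hinv _ g xs ρ κ hloc hA.zero b hb x mk p q hrun hx0.1
      ((mul_le_mul_of_nonneg_left hx0.2.1 he.le).trans hs₁') k (fun j hj => hres j (by omega))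
    have hC := hrun.cycle P hloc hA.zero hb (k := k) (fun j hj => hball j (by omega))
    have hnk := (hrun.depth_of_cycle _ k rfl).1
    have h1 := H₂ (C₁ + C₂) (by linarith) g xs ρ κ x p q b _ _ hloc hA.zero hC (hrun.depth_le k) (by
      calc κ * ‖x (k - mk k) - xs‖ ≤ κ * (e * ‖x 0 - xs‖) := by
            gcongr; exact hcmp _ (Nat.sub_le _ _)
        _ ≤ κ * (e * s₂) := by gcongr; exact hx0.2.2
        _ = κ * e * s₂ := by ring
        _ ≤ δ₂ := hs₂') (hball _ (by omega))
    rwa [← add_assoc, Nat.sub_add_cancel hnk] at h1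
  · have hρ := hloc.rho_pos
    have hκ := hloc.kappa_pos
    obtain ⟨s₁, hs₁, hs₁'⟩ := RestartedAM.exists_pos_mul_le e' ρ hρ
    obtain ⟨s₂, hs₂, hs₂'⟩ := RestartedAM.exists_pos_mul_le (κ * e') δ₂ hδ₂
    -- With this radius the quadratic term is at most `(1 - θ) μ E ≤ (1 - θ) ‖r_s‖`, which is what
    -- the contraction leaves free.
    obtain ⟨s₃, hs₃, hs₃'⟩ := RestartedAM.exists_pos_mul_le (κ * (C₁ + C₂) * e') ((1 - θ) * μ)
      (mul_pos (by linarith [hθ.2]) hμ)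
    refine ⟨min ρ (min s₁ (min s₂ s₃)), by positivity,
      fun b hb hbθ x mk p q hrun hx0 => ?_⟩
    simp only [le_min_iff] at hx0
    have key : ∀ k, (∀ j ≤ k, ‖RestartedAM.residual g (x j)‖ ≤
          1 * ‖RestartedAM.residual g (x 0)‖) →
        (RestartedAM.BoundII g xs κ (C₁ + C₂) (b k) (mk k) (x (k - mk k)) (x (k + 1)) ∧
          (mk k = d → ‖x (k + 1) - xs‖ ≤ κ * ((C₁ + C₂) * ‖x (k - mk k) - xs‖ ^ 2))) ∧
        x (k - mk k) ∈ Metric.closedBall xs ρ ∧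
        ‖x (k - mk k) - xs‖ ≤ e' * ‖x 0 - xs‖ := by
      intro k hres
      obtain ⟨hball, hcmp⟩ := hinv' _ g xs ρ κ hloc hA.zero b hb x mk p q hrun hx0.1
        ((mul_le_mul_of_nonneg_left hx0.2.1 he'.le).trans hs₁') k hres
      have hC := hrun.cycle P hloc hA.zero hb (k := k) (fun j hj => hball j (by omega))
      have hnk := (hrun.depth_of_cycle _ k rfl).1
      have h1 := H₂ (C₁ + C₂) (by linarith) g xs ρ κ x p q b _ _ hloc hA.zero hC
        (hrun.depth_le k) (by
        calc κ * ‖x (k - mk k) - xs‖ ≤ κ * (e' * ‖x 0 - xs‖) := by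
              gcongr; exact hcmp _ (Nat.sub_le _ _)
          _ ≤ κ * (e' * s₂) := by gcongr; exact hx0.2.2.1
          _ = κ * e' * s₂ := by ring
          _ ≤ δ₂ := hs₂') (hball _ (by omega))
      rw [← add_assoc, Nat.sub_add_cancel hnk] at h1
      exact ⟨h1, hball _ (by omega), hcmp _ (Nat.sub_le _ _)⟩
    have hres : ∀ k, ‖RestartedAM.residual g (x k)‖ ≤ 1 * ‖RestartedAM.residual g (x 0)‖ := by
      intro k
      induction k using Nat.strong_induction_on with
      | _ k ih =>
        rcases k with _ | k
        · rw [one_mul]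
        obtain ⟨⟨⟨M, hM, hbd⟩, -⟩, hs, hsn⟩ := key k (fun j hj => ih j (by omega))
        -- The new residual is compared with the one at the last restart, not with its predecessor.
        refine le_trans ?_ (ih (k - mk k) (by omega))
        set R := ‖RestartedAM.residual g (x (k - mk k))‖ with hR
        set E := ‖x (k - mk k) - xs‖ with hE
        -- The constant polynomial `1` is a competitor.
        have hM1 : M ≤ R := hM.2 ((RestartedAM.mem_polyValues_iff _ _ _ _).2
          ⟨0, zero_mem _, by simp [hR]⟩)
        have hM0 : 0 ≤ M := by
          obtain ⟨z, -, hz⟩ := (RestartedAM.mem_polyValues_iff _ _ _ _).1 hM.1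
          rw [hz]; positivity
        have hlow : μ * E ≤ R := hloc.residual_lower hA.zero hs
        have h1 : κ * ((C₁ + C₂) * E ^ 2) ≤ (1 - θ) * R := by
          calc κ * ((C₁ + C₂) * E ^ 2) = κ * (C₁ + C₂) * E * E := by ring
            _ ≤ κ * (C₁ + C₂) * (e' * s₃) * E := by
                gcongr
                exact hsn.trans (by gcongr; exact hx0.2.2.2)
            _ = κ * (C₁ + C₂) * e' * s₃ * E := by ring
            _ ≤ (1 - θ) * μ * E := by gcongr
            _ = (1 - θ) * (μ * E) := by ring
            _ ≤ (1 - θ) * R := by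
                have : 0 ≤ 1 - θ := by linarith [hθ.2]
                gcongr
        have hθ0 : 0 ≤ θ := (Real.sqrt_nonneg _).trans hθ.1
        calc ‖RestartedAM.residual g (x (k + 1))‖ ≤ _ := hbd
          _ ≤ θ * R + (1 - θ) * R := by
              refine add_le_add ?_ h1
              exact mul_le_mul (hbθ k) hM1 hM0 hθ0
          _ = R := by ring
    exact fun k => (key k fun j _ => hres j).1
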